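/- Throughout, $V$ is a finite set, and a hypergraph $\mathcal H$ on $V$ is a set of subsets (faces) of $V$ whose union is $V$. It is *separated* if for all distinct $i,j\in V$ there are faces $F_1,F_2$ with $i\in F_1\setminus F_2$ and $j\in F_2\setminus F_1$, and *1-dimensional* if all faces have at most two elements and some face has exactly two. A vertex $v$ is *closed* if $\{v\}\in\mathcal H$ and *open* otherwise. Two distinct vertices are *neighbors* (or *adjacent*) if they lie in a common face; connectedness is with respect to this relation. A *joint* is a vertex with at least three neighbors. Let $k$ be a field. For a hypergraph $\mathcal H$ let $R=k[x_F: F\in\mathcal H]$, $m_v=\prod_{F\ni v}x_F$ for each vertex $v$, $I(\mathcal H)=(m_v : v \text{ a vertex of }\mathcal H)\subseteq R$, and $\operatorname{pd}(\mathcal H)=\operatorname{pd}_R(R/I(\mathcal H))$. Conversely, the hypergraph of a square-free monomial ideal $J$ has the minimal monomial generators of $J$ as vertices and, for each variable $x$ of the ring, the set of generators divisible by $x$ as a face. Let $\mathcal H_w$ be the hypergraph on $V\setminus\{w\}$ with faces $F\setminus\{w\}$, $F\in\mathcal H$ (that is, the hypergraph of the ideal generated by the $m_v$ with $v\ne w$),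 and for $F\in\mathcal H$ let $\mathcal H:F$ be the hypergraph of the ideal $I(\mathcal H):x_F$ (cancellation of $F$). A *string* is a hypergraph whose vertices can be listed as $v_1,\dots,v_n$ $(n\ge1)$ so that its faces with at least two elements are exactly $\{v_i,v_{i+1}\}$, $1\le i<n$. A *branch* of $\mathcal H$ from $w$ is a connected component of $\mathcal H_w$ that is a string. **Proposition.** Let $\mathcal H$ be a separated 1-dimensional hypergraph, $w$ a joint of $\mathcal H$, $\mathcal S$ a branch of $\mathcal H$ from $w$ no two of whose vertices are adjacent and both closed in $\mathcal H$, and let $E\in\mathcal H$ be an edge joining $w$ to a vertex of $\mathcal S$. (a) If $\mathcal S$ has exactly one vertex, then $\operatorname{pd}(\mathcal H)=\operatorname{pd}(\mathcal H:E)$. (b) If $\mathcal S$ has exactly two vertices, then $\operatorname{pd}(\mathcal H)=\operatorname{pd}(\mathcal H_w)$. -/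

import Mathlib

universe u v

/-! A hypergraph on a vertex set `V` is a set `H : Set (Set V)` of faces that covers `V`. -/

namespace DualHypergraph

section Combinatorics

variable {V : Type u}

/-- The faces of `H` cover the vertex set. -/
def Covers (H : Set (Set V)) : Prop :=
  ⋃₀ H = Set.univ

/-- `H` is separated: any two distinct vertices are separated by faces, in both directions. -/
def Separated (H : Set (Set V)) : Prop :=
  ∀ i j : V, i ≠ j → ∃ F₁ ∈ H, ∃ F₂ ∈ H, (i ∈ F₁ ∧ i ∉ F₂) ∧ (j ∈ F₂ ∧ j ∉ F₁)

/-- Every face has dimension at most `1`, i.e. at most two vertices, and some face has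
dimension exactly `1`. -/
def OneDimensional (H : Set (Set V)) : Prop :=
  (∀ F ∈ H, F.encard ≤ 2) ∧ ∃ F ∈ H, F.encard = 2

/-- The graph whose edges are the pairs of neighbors: distinct vertices lying in a common face. -/
def neighborGraph (H : Set (Set V)) : SimpleGraph V where
  Adj a b := a ≠ b ∧ ∃ F ∈ H, a ∈ F ∧ b ∈ F
  symm := ⟨fun _ _ h => ⟨h.1.symm, h.2.imp fun _ hF => ⟨hF.1, hF.2.2, hF.2.1⟩⟩⟩
  loopless := ⟨fun _ h => h.1 rfl⟩

/-- A vertex is closed if its singleton is a face, and open otherwise. -/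
def IsClosedVertex (H : Set (Set V)) (a : V) : Prop :=
  {a} ∈ H

/-- A joint is a vertex with at least three neighbors. -/
def IsJoint (H : Set (Set V)) (w : V) : Prop :=
  3 ≤ ((neighborGraph H).neighborSet w).encard

/-- The hypergraph `H_w` obtained by removing the vertex `w` and contracting the faces that
contain it. It is the hypergraph of the remaining monomial generators, see
`hypergraphOfMonomials_removed` below. -/
def remove (H : Set (Set V)) (w : V) : Set (Set {a : V // a ≠ w}) :=
  (fun F : Set V => {a : {a : V // a ≠ w} | (a : V) ∈ F}) '' H

/-- The restriction `{F ∈ H | F ⊆ U}` of `H`, as a hypergraph with vertex set `U`. -/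
def restrict (H : Set (Set V)) (U : Set V) : Set (Set U) :=
  {G | Subtype.val '' G ∈ H}

/-- `H` is a string: its vertices can be enumerated as `e 0, …, e (n - 1)`, `n ≥ 1`, so that the
faces with at least two vertices are exactly the edges `{e i, e (i + 1)}`. -/
def IsString (H : Set (Set V)) : Prop :=
  ∃ n : ℕ, 1 ≤ n ∧ ∃ e : Fin n ≃ V, ∀ F : Set V, F.Nontrivial →
    (F ∈ H ↔ ∃ i j : Fin n, (j : ℕ) = (i : ℕ) + 1 ∧ F = {e i, e j})

/-- `S` is the vertex set of a branch of `H` from `w`: a connected component of `H_w` that is a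
string hypergraph. -/
def IsBranch (H : Set (Set V)) (w : V) (S : Set V) : Prop :=
  ∃ C : (neighborGraph (remove H w)).ConnectedComponent,
    S = Subtype.val '' C.supp ∧ IsString (restrict (remove H w) C.supp)

end Combinatorics

section Algebra

/-- The hypergraph of a family of monomials `m j`: each variable `X i` gives the face of all
indices `j` with `X i ∣ m j`. -/
def hypergraphOfMonomials {k : Type v} [Field k] {σ : Type u} {ι : Type*}
    (m : ι → MvPolynomial σ k) : Set (Set ι) :=
  Set.range fun i : σ => {j | MvPolynomial.X i ∣ m j}

/-- The exponents of the minimal monomial generators of a monomial ideal `I`. -/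
def minGens {k : Type v} [Field k] {σ : Type u} (I : Ideal (MvPolynomial σ k)) :
    Set (σ →₀ ℕ) :=
  {s | Minimal (fun t : σ →₀ ℕ => MvPolynomial.monomial t (1 : k) ∈ I) s}

/-- The hypergraph `H(I)` of a square-free monomial ideal `I`; its vertices are the minimal
monomial generators of `I`. -/
def hypergraphOfIdeal {k : Type v} [Field k] {σ : Type u} (I : Ideal (MvPolynomial σ k)) :
    Set (Set (minGens I)) :=
  hypergraphOfMonomials fun s : minGens I => MvPolynomial.monomial (s : σ →₀ ℕ) (1 : k)

variable (k : Type v) [Field k] {V : Type u}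

/-- The square-free monomial `m_a` in the variables `x_F`, `F ∈ H`: the product of all `x_F` with
`a ∈ F`. (`∏ᶠ` is an ordinary product when `H` has finitely many faces.) -/
noncomputable def vertexMonomial (H : Set (Set V)) (a : V) : MvPolynomial H k :=
  ∏ᶠ (F : H) (_ : a ∈ F.1), MvPolynomial.X F

/-- The standard square-free monomial ideal `I(H)`, with one variable `x_F` for each face. -/
noncomputable def standardIdeal (H : Set (Set V)) : Ideal (MvPolynomial H k) :=
  Ideal.span (Set.range (vertexMonomial k H))

/-- The projective dimension of a hypergraph: `pd (R / I(H))` with `R = k[x_F : F ∈ H]`. -/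
noncomputable def pd (H : Set (Set V)) : WithBot ℕ∞ :=
  CategoryTheory.projectiveDimension
    (ModuleCat.of (MvPolynomial H k) (MvPolynomial H k ⧸ standardIdeal k H))

/-- The hypergraph `H : F` obtained by cancelling the face `F`: the hypergraph of the colon ideal
`I(H) : x_F`. -/
def cancel (H : Set (Set V)) (F : H) :
    Set (Set (minGens ((standardIdeal k H).colon {(MvPolynomial.X F : MvPolynomial H k)}))) :=
  hypergraphOfIdeal ((standardIdeal k H).colon {(MvPolynomial.X F : MvPolynomial H k)})

lemma X_dvd_vertexMonomial_iff [Finite V] (H : Set (Set V)) (F : H) (a : V) :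
    (MvPolynomial.X F : MvPolynomial H k) ∣ vertexMonomial k H a ↔ a ∈ F.1 := by
  classical
  have _ : Fintype H := Fintype.ofFinite H
  have hm : vertexMonomial k H a
      = ∏ G ∈ Finset.univ.filter (fun G : H => a ∈ G.1), MvPolynomial.X G := by
    unfold vertexMonomial
    refine (finprod_mem_eq_finite_toFinset_prod _ (Set.toFinite {G : H | a ∈ G.1})).trans ?_
    congr 1
    ext G
    simp
  rw [hm]
  constructor
  · intro h
    obtain ⟨G, hG, hd⟩ := (Prime.dvd_finsetProd_iff (MvPolynomial.X_prime (i := F)) _).1 h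
    rw [MvPolynomial.X_dvd_X] at hd
    subst hd
    simpa using hG
  · intro h
    exact Finset.dvd_prod_of_mem _ (by simpa using h)

/-- `H_w` is the hypergraph of the monomial generators of `I(H)` other than `m_w`. -/
theorem hypergraphOfMonomials_removed [Finite V] (H : Set (Set V)) (w : V) :
    hypergraphOfMonomials (fun a : {a : V // a ≠ w} => vertexMonomial k H a) = remove H w := by
  ext G
  simp [hypergraphOfMonomials, remove, X_dvd_vertexMonomial_iff]

end Algebra

end DualHypergraph

/-!
Write `R / I(G)` for the quotient by the square-free monomial ideal of a family `G` of sets of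
variables, and `J` for the ideal of the generators `m_v` with `v` outside of `S ∪ {w}`.

Everything follows from a few inequalities between projective dimensions of such quotients.
Setting some variables to `1` (`famPd_erase_le`) or to `0` (`famPd_avoid_le`) does not raise the
projective dimension: over the polynomial ring in the other variables, over which `R` is free, the
specialized quotient is a direct summand of `R / I(G)`. The exact sequence
`0 → R / (I : m) → R / I → R / (I + (m)) → 0` shows that one more generator raises it by at most
one (`famPd_insert_le`), and bounds it by the values of the specializations at `x = 1` and, plus
one, at `x = 0` (`famPd_le_max_erase_avoid`). A new variable as generator raises it by exactly one
(`famPd_add_one_le`); this rests on `PdLT.of_smul_eq_zero`, which compares the projective dimensions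
over `A` and over `A[x]` of a module killed by `x`.

If `S = {s}`, then `s` is closed. Specializing at `x_E = 0` leaves `J`, so one has to show that
`I : x_E`, which is generated by the variable of the face `{s}`, by `m_w / x_E` and by `J`, has
projective dimension at least `pd J + 1`. This follows from `famPd_le_insert`: adding `m_w / x_E`
to `J` does not lower the projective dimension, because some variable of it, the edge to another
neighbor of `w`, divides at most one generator of `J`.

If `S` has two vertices, then one of them is open and joined to `w`, and both projective dimensions
are `pd J + 2` (`IsBranch.pd_eq_remove`).

The faces of `H_w` and of `H : E` arise from the variables `x_F` by identifying those that divide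
the same generators; `famPd_preimage` shows that this is harmless in the cases that occur.
-/

/-! ### Projective dimension and change of rings -/

universe t

namespace DualHypergraph

/-- `PdLT R M n` says that the `R`-module `M` has projective dimension less than `n`. In particular
`PdLT R M 0` means `M = 0`. -/
abbrev PdLT (R : Type t) [Ring R] (M : Type t) [AddCommGroup M] [Module R M] (n : ℕ) : Prop :=
  CategoryTheory.HasProjectiveDimensionLT (ModuleCat.of R M) n

section Ring

variable {R : Type t} [CommRing R] {M M' M'' : Type t} [AddCommGroup M] [AddCommGroup M']
  [AddCommGroup M''] [Module R M] [Module R M'] [Module R M'']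

lemma PdLT.mono {n m : ℕ} (h : PdLT R M n) (hnm : n ≤ m) : PdLT R M m :=
  CategoryTheory.hasProjectiveDimensionLT_of_ge _ n m hnm

lemma pdLT_zero_iff : PdLT R M 0 ↔ Subsingleton M := by
  rw [PdLT, CategoryTheory.hasProjectiveDimensionLT_zero_iff_isZero,
    ModuleCat.isZero_iff_subsingleton]

lemma pdLT_one_iff : PdLT R M 1 ↔ Module.Projective R M := by
  rw [PdLT, ← CategoryTheory.projective_iff_hasProjectiveDimensionLT_one,
    ← IsProjective.iff_projective]

lemma PdLT.of_retract {n : ℕ} (h : PdLT R M n) (i : M' →ₗ[R] M) (r : M →ₗ[R] M')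
    (hri : ∀ x, r (i x) = x) : PdLT R M' n :=
  CategoryTheory.Retract.hasProjectiveDimensionLT (Y := ModuleCat.of R M)
    ⟨ModuleCat.ofHom i, ModuleCat.ofHom r, by ext x; exact hri x⟩ n

lemma PdLT.of_equiv {n : ℕ} (h : PdLT R M n) (e : M ≃ₗ[R] M') : PdLT R M' n :=
  h.of_retract e.symm.toLinearMap e.toLinearMap (by simp)

section Exact

variable (f : M' →ₗ[R] M) (g : M →ₗ[R] M'') (hf : Function.Injective f)
  (hg : Function.Surjective g) (hfg : Function.Exact f g)

include hf hg hfg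

lemma shortExact_of_exact : (ModuleCat.shortComplexOfCompEqZero f g
    hfg.linearMap_comp_eq_zero).ShortExact :=
  ModuleCat.shortComplex_shortExact _ hfg hf hg

lemma PdLT.middle {n : ℕ} (h₁ : PdLT R M' n) (h₃ : PdLT R M'' n) : PdLT R M n :=
  (shortExact_of_exact f g hf hg hfg).hasProjectiveDimensionLT_X₂ n h₁ h₃

lemma PdLT.right {n : ℕ} (h₁ : PdLT R M' n) (h₂ : PdLT R M (n + 1)) : PdLT R M'' (n + 1) :=
  (shortExact_of_exact f g hf hg hfg).hasProjectiveDimensionLT_X₃ n h₁ h₂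

lemma PdLT.left {n : ℕ} (h₂ : PdLT R M n) (h₃ : PdLT R M'' (n + 1)) : PdLT R M' n :=
  (shortExact_of_exact f g hf hg hfg).hasProjectiveDimensionLT_X₁ n h₂ h₃

end Exact

variable (R M) in
/-- The standard free cover `R^(M) → M`. -/
noncomputable abbrev freeCover : (M →₀ R) →ₗ[R] M := Finsupp.linearCombination R id

lemma freeCover_surjective : Function.Surjective (freeCover R M) :=
  Finsupp.linearCombination_id_surjective R M

lemma pdLT_ker_freeCover {n : ℕ} (h : PdLT R M (n + 2)) :
    PdLT R (LinearMap.ker (freeCover R M)) (n + 1) :=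
  PdLT.left (LinearMap.ker (freeCover R M)).subtype (freeCover R M)
    (Submodule.subtype_injective _) freeCover_surjective
    (LinearMap.exact_subtype_ker_map _) ((pdLT_one_iff.2 inferInstance).mono (by lia)) h

section Colon

variable {I J K : Ideal R} {x : R} (hJ : ∀ r, r * x ∈ I ↔ r ∈ J) (hK : K = I ⊔ Ideal.span {x})

/-- Multiplication by `x`, as a map from `R / (I : x)` to `R / I`. -/
noncomputable def mulQuotient (hJ : ∀ r, r * x ∈ I ↔ r ∈ J) : (R ⧸ J) →ₗ[R] (R ⧸ I) :=
  Submodule.mapQ J I (LinearMap.mulRight R x) fun r hr => (hJ r).2 hr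

lemma mulQuotient_mk (r : R) :
    mulQuotient hJ (Ideal.Quotient.mk J r) = Ideal.Quotient.mk I (r * x) := rfl

/-- The projection from `R / I` to `R / (I + (x))`. -/
noncomputable def projQuotient (hK : K = I ⊔ Ideal.span {x}) : (R ⧸ I) →ₗ[R] (R ⧸ K) :=
  Submodule.mapQ I K LinearMap.id fun r hr => by
    rw [hK]; exact Ideal.mem_sup_left hr

lemma projQuotient_mk (r : R) :
    projQuotient hK (Ideal.Quotient.mk I r) = Ideal.Quotient.mk K r := rfl

lemma mulQuotient_injective : Function.Injective (mulQuotient hJ) := by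
  rw [injective_iff_map_eq_zero]
  intro y hy
  obtain ⟨r, rfl⟩ := Ideal.Quotient.mk_surjective y
  rw [mulQuotient_mk, Ideal.Quotient.eq_zero_iff_mem, hJ] at hy
  exact Ideal.Quotient.eq_zero_iff_mem.2 hy

lemma projQuotient_surjective : Function.Surjective (projQuotient hK) := fun y => by
  obtain ⟨r, rfl⟩ := Ideal.Quotient.mk_surjective y
  exact ⟨Ideal.Quotient.mk I r, rfl⟩

lemma exact_mulQuotient_projQuotient :
    Function.Exact (mulQuotient hJ) (projQuotient hK) := by
  intro y
  obtain ⟨r, rfl⟩ := Ideal.Quotient.mk_surjective y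
  rw [projQuotient_mk, Ideal.Quotient.eq_zero_iff_mem, hK, sup_comm, Ideal.mem_span_singleton_sup]
  constructor
  · rintro ⟨a, b, hb, rfl⟩
    refine ⟨Ideal.Quotient.mk J a, ?_⟩
    rw [mulQuotient_mk, map_add, Ideal.Quotient.eq_zero_iff_mem.2 hb, add_zero]
  · rintro ⟨z, hz⟩
    obtain ⟨a, rfl⟩ := Ideal.Quotient.mk_surjective z
    rw [mulQuotient_mk, eq_comm, Ideal.Quotient.eq] at hz
    exact ⟨a, _, hz, by ring⟩

include hJ hK in
lemma PdLT.of_colon {n : ℕ} (h₁ : PdLT R (R ⧸ J) n) (h₂ : PdLT R (R ⧸ K) n) :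
    PdLT R (R ⧸ I) n :=
  PdLT.middle _ _ (mulQuotient_injective hJ) (projQuotient_surjective hK)
    (exact_mulQuotient_projQuotient hJ hK) h₁ h₂

include hJ hK in
lemma PdLT.of_sup_span {n : ℕ} (h₁ : PdLT R (R ⧸ J) n) (h₂ : PdLT R (R ⧸ I) (n + 1)) :
    PdLT R (R ⧸ K) (n + 1) :=
  PdLT.right _ _ (mulQuotient_injective hJ) (projQuotient_surjective hK)
    (exact_mulQuotient_projQuotient hJ hK) h₁ h₂

end Colon

end Ring

section Algebra

variable {A R : Type t} [CommRing A] [CommRing R] [Algebra A R]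

lemma projective_restrictScalars [Module.Free A R] (M : Type t) [AddCommGroup M]
    [Module R M] [Module A M] [IsScalarTower A R M] [Module.Projective R M] :
    Module.Projective A M := by
  obtain ⟨s, hs⟩ := Module.projective_def.1 (inferInstance : Module.Projective R M)
  have : Module.Free A (M →₀ R) := Module.Free.finsupp A R M
  exact Module.Projective.of_split (s.restrictScalars A) ((freeCover R M).restrictScalars A)
    (LinearMap.ext hs)

lemma PdLT.restrictScalars [Module.Free A R] {n : ℕ} {M : Type t} [AddCommGroup M]
    [Module R M] [Module A M] [IsScalarTower A R M] (h : PdLT R M n) : PdLT A M n := by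
  induction n generalizing M with
  | zero => rwa [pdLT_zero_iff] at h ⊢
  | succ n ih =>
    cases n with
    | zero =>
      simp only [zero_add] at h ⊢
      rw [pdLT_one_iff] at h ⊢
      exact projective_restrictScalars (R := R) M
    | succ n =>
      have hK := ih (pdLT_ker_freeCover h)
      have : Module.Free A (M →₀ R) := Module.Free.finsupp A R M
      exact PdLT.right ((LinearMap.ker (freeCover R M)).subtype.restrictScalars A)
        ((freeCover R M).restrictScalars A) (Submodule.subtype_injective _) freeCover_surjective
        (LinearMap.exact_subtype_ker_map (freeCover R M)) hK
        ((pdLT_one_iff.2 inferInstance).mono (by lia))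

open TensorProduct in
lemma PdLT.baseChange_right [Module.Flat A R] {n : ℕ} {K F M : Type t} [AddCommGroup K]
    [AddCommGroup F] [AddCommGroup M] [Module A K] [Module A F] [Module A M]
    (f : K →ₗ[A] F) (g : F →ₗ[A] M) (hf : Function.Injective f) (hg : Function.Surjective g)
    (hfg : Function.Exact f g) (hK : PdLT R (R ⊗[A] K) n) (hF : PdLT R (R ⊗[A] F) (n + 1)) :
    PdLT R (R ⊗[A] M) (n + 1) :=
  PdLT.right (f.baseChange R) (g.baseChange R)
    (Module.Flat.lTensor_preserves_injective_linearMap (M := R) f hf)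
    (LinearMap.lTensor_surjective R hg) (lTensor_exact R hfg hg) hK hF

open TensorProduct in
lemma PdLT.baseChange [Module.Flat A R] {n : ℕ} {M : Type t} [AddCommGroup M]
    [Module A M] (h : PdLT A M n) : PdLT R (R ⊗[A] M) n := by
  induction n generalizing M with
  | zero =>
    rw [pdLT_zero_iff] at h ⊢
    infer_instance
  | succ n ih =>
    cases n with
    | zero =>
      simp only [zero_add] at h ⊢
      rw [pdLT_one_iff] at h ⊢
      infer_instance
    | succ n =>
      have hK := ih (pdLT_ker_freeCover h)
      have hfree : PdLT R (R ⊗[A] (M →₀ A)) (n + 2) :=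
        (pdLT_one_iff.2 inferInstance).mono (by lia)
      exact PdLT.baseChange_right _ _ (Submodule.subtype_injective _) freeCover_surjective
        (LinearMap.exact_subtype_ker_map (freeCover A M)) hK hfree

lemma PdLT.quotient_map [Module.Flat A R] {n : ℕ} {I : Ideal A} (h : PdLT A (A ⧸ I) n) :
    PdLT R (R ⧸ I.map (algebraMap A R)) n :=
  (PdLT.baseChange (R := R) h).of_equiv
    (Algebra.TensorProduct.quotIdealMapEquivTensorQuot R I).symm.toLinearEquiv

/-- If an `A`-algebra retraction `φ : R → A` carries `J` into `I`, and some `r` with `φ r = 1`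
multiplies `I` into `J`, then multiplication by `r` makes `A / I` an `A`-module retract
of `R / J`. -/
lemma PdLT.of_algebra_retraction {n : ℕ} {I : Ideal A} {J : Ideal R}
    (h : PdLT A (R ⧸ J) n) (φ : R →ₐ[A] A) (hφ : ∀ x ∈ J, φ x ∈ I) (r : R) (hr : φ r = 1)
    (hrI : ∀ a ∈ I, algebraMap A R a * r ∈ J) : PdLT A (A ⧸ I) n := by
  refine h.of_retract
    (Submodule.liftQ (I.restrictScalars A)
      ((Ideal.Quotient.mkₐ A J).toLinearMap ∘ₗ LinearMap.toSpanSingleton A R r) ?_)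
    (Submodule.liftQ (J.restrictScalars A)
      ((Ideal.Quotient.mkₐ A I).toLinearMap ∘ₗ φ.toLinearMap) ?_) ?_
  · intro a ha
    change Ideal.Quotient.mk J (a • r) = 0
    rw [Ideal.Quotient.eq_zero_iff_mem, Algebra.smul_def]
    exact hrI a ha
  · intro x hx
    simpa [Ideal.Quotient.eq_zero_iff_mem] using hφ x hx
  · intro x
    obtain ⟨a, rfl⟩ := Ideal.Quotient.mk_surjective x
    change Ideal.Quotient.mk I (φ (a • r)) = _
    rw [map_smul, hr, smul_eq_mul, mul_one]

end Algebra

section Kill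

variable {A R : Type t} [CommRing A] [CommRing R] [Algebra A R]

/-- Suppose that `x` kills `N`, and that `φ` and `δ` read off the constant and the linear
coefficient in `x`. The kernel `K` of the free cover of `N` is projective over `R`, so `K / x K` is
projective over `A`, and multiplication by `x` and `δ` exhibit `N` as a retract of it. The proof
embeds `K` into a free module by a section `s` and writes `N` as a retract of the free `A`-module
on `K` directly. -/
lemma projective_of_pdLT_two (x : R) (φ : R →ₐ[A] A)
    (hφx : φ x = 0) (δ : R →ₗ[A] A) (hδ : ∀ r, δ (x * r) = φ r)
    (hker : ∀ r, φ r = 0 → x ∣ r)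
    {N : Type t} [AddCommGroup N] [Module R N] [Module A N] [IsScalarTower A R N]
    (hN : ∀ y : N, x • y = 0) (h : PdLT R N 2) : Module.Projective A N := by
  have hact : ∀ (r : R) (y : N), r • y = φ r • y := by
    intro r y
    obtain ⟨d, hd⟩ := hker (r - algebraMap A R (φ r)) (by simp)
    have : r = algebraMap A R (φ r) + x * d := by rw [← hd]; ring
    conv_lhs => rw [this]
    rw [add_smul, mul_comm, mul_smul, hN, smul_zero, add_zero, algebraMap_smul]
  let g := freeCover R N
  have hK : Module.Projective R (LinearMap.ker g) := pdLT_one_iff.1 (pdLT_ker_freeCover h)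
  obtain ⟨s, hs⟩ := Module.projective_def.1 hK
  -- the linear coefficient in `x` of the free cover, and its restriction to the kernel
  let ρ : (N →₀ R) →ₗ[A] N := freeCover A N ∘ₗ Finsupp.mapRange.linearMap δ
  have hρx : ∀ q, ρ (x • q) = g q := by
    intro q
    induction q using Finsupp.induction_linear with
    | zero => simp
    | add p q hp hq => rw [smul_add, map_add, map_add, hp, hq]
    | single y r =>
      rw [Finsupp.smul_single, smul_eq_mul]
      simp only [ρ, g, LinearMap.comp_apply, Finsupp.mapRange.linearMap_apply,
        Finsupp.mapRange_single, hδ, Finsupp.linearCombination_single, hact, id]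
  have hρ : ∀ (r : R) (q : LinearMap.ker g), ρ (r • (q : N →₀ R)) = φ r • ρ q := by
    intro r q
    obtain ⟨d, hd⟩ := hker (r - algebraMap A R (φ r)) (by simp)
    have : r = algebraMap A R (φ r) + x * d := by rw [← hd]; ring
    conv_lhs => rw [this]
    rw [add_smul, mul_smul, map_add, hρx, g.map_smul, LinearMap.mem_ker.1 q.2, smul_zero, add_zero,
      algebraMap_smul, ρ.map_smul]
  let μ : (N →₀ R) →ₗ[R] LinearMap.ker g :=
    LinearMap.codRestrict _ (LinearMap.lsmul R (N →₀ R) x) (by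
      intro q
      simp [hN])
  let red : (LinearMap.ker g →₀ R) →ₗ[A] (LinearMap.ker g →₀ A) :=
    Finsupp.mapRange.linearMap φ.toLinearMap
  have hred : ∀ p, red (x • p) = 0 := by
    intro p
    ext q
    simp [red, hφx]
  let θ : (N →₀ R) →ₗ[A] (LinearMap.ker g →₀ A) :=
    red ∘ₗ s.restrictScalars A ∘ₗ μ.restrictScalars A
  have hθ : LinearMap.ker (g.restrictScalars A) ≤ LinearMap.ker θ := by
    intro q hq
    have : μ q = x • (⟨q, hq⟩ : LinearMap.ker g) := by ext; rfl
    change red (s (μ q)) = 0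
    rw [this, map_smul, hred]
  let e := (g.restrictScalars A).quotKerEquivOfSurjective freeCover_surjective
  let i : N →ₗ[A] (LinearMap.ker g →₀ A) := Submodule.liftQ _ θ hθ ∘ₗ e.symm.toLinearMap
  have hi : ∀ q, i (g q) = θ q := by
    intro q
    have : e.symm (g q) = Submodule.Quotient.mk q := by
      rw [LinearEquiv.symm_apply_eq]; rfl
    change Submodule.liftQ _ θ hθ (e.symm (g q)) = θ q
    rw [this, Submodule.liftQ_apply]
  let r : (LinearMap.ker g →₀ A) →ₗ[A] N :=
    Finsupp.linearCombination A fun q : LinearMap.ker g => ρ q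
  have hr : ∀ p : LinearMap.ker g →₀ R,
      r (red p) = ρ (Finsupp.linearCombination R id p : LinearMap.ker g) := by
    intro p
    induction p using Finsupp.induction_linear with
    | zero => simp
    | add p q hp hq => simp only [map_add, hp, hq, Submodule.coe_add]
    | single q a => simp [r, red, hρ]
  refine Module.Projective.of_split i r (LinearMap.ext fun y => ?_)
  obtain ⟨q, rfl⟩ := freeCover_surjective (R := R) y
  change r (i (g q)) = g q
  rw [hi]
  change r (red (s (μ q))) = g q
  rw [hr, hs (μ q)]
  exact hρx q

/-- If `x` is a variable of `R` over `A`, then a nonzero `A`-module, regarded as an `R`-module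
killed by `x`, has projective dimension over `R` larger than over `A`. -/
lemma PdLT.of_smul_eq_zero (x : R) (φ : R →ₐ[A] A)
    (hφx : φ x = 0) (δ : R →ₗ[A] A) (hδ : ∀ r, δ (x * r) = φ r)
    (hker : ∀ r, φ r = 0 → x ∣ r) (hx : ∀ r, x * r = 0 → r = 0)
    {n : ℕ} {N : Type t} [AddCommGroup N] [Module R N] [Module A N] [IsScalarTower A R N]
    (hN : ∀ y : N, x • y = 0) (h : PdLT R N (n + 1)) : PdLT A N n := by
  induction n using Nat.strong_induction_on generalizing N with
  | _ n ih =>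
  match n with
  | 0 =>
    simp only [zero_add] at h
    rw [pdLT_one_iff] at h
    rw [pdLT_zero_iff]
    obtain ⟨s, hs⟩ := Module.projective_def.1 h
    have h0 : ∀ y : N, y = 0 := by
      intro y
      have hy : s y = 0 := by
        ext z
        refine hx _ ?_
        rw [← smul_eq_mul, ← Finsupp.smul_apply, ← map_smul, hN, map_zero, Finsupp.zero_apply]
      rw [← hs y, hy, map_zero]
    exact ⟨fun a b => (h0 a).trans (h0 b).symm⟩
  | 1 => exact pdLT_one_iff.2 (projective_of_pdLT_two x φ hφx δ hδ hker hN h)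
  | n + 2 =>
    have hact : ∀ (r : R) (y : N), r • y = φ r • y := by
      intro r y
      obtain ⟨d, hd⟩ := hker (r - algebraMap A R (φ r)) (by simp)
      have : r = algebraMap A R (φ r) + x * d := by rw [← hd]; ring
      conv_lhs => rw [this]
      rw [add_smul, mul_comm, mul_smul, hN, smul_zero, add_zero, algebraMap_smul]
    -- the free `A`-module covering `N` is an `R`-module of projective dimension at most one
    let F := N →₀ A
    let _ : Module R F := Module.compHom F φ.toRingHom
    have hFact : ∀ (r : R) (y : F), r • y = φ r • y := fun _ _ => rfl
    have : IsScalarTower A R F := ⟨fun a r y => by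
      rw [hFact, hFact, map_smul, smul_assoc]⟩
    let m : (N →₀ R) →ₗ[R] (N →₀ R) := LinearMap.lsmul R (N →₀ R) x
    let p : (N →₀ R) →ₗ[R] F :=
      { Finsupp.mapRange.linearMap φ.toLinearMap with
        map_smul' := by
          intro r y
          ext z
          change φ (r * y z) = φ r * φ (y z)
          rw [map_mul] }
    have hF : PdLT R F 2 := by
      refine PdLT.right m p ?_ ?_ ?_ (pdLT_one_iff.2 inferInstance)
        ((pdLT_one_iff.2 inferInstance).mono (by lia))
      · rw [injective_iff_map_eq_zero]
        intro q hq
        ext z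
        exact hx _ (DFunLike.congr_fun hq z)
      · exact Finsupp.mapRange_surjective φ (map_zero φ)
          (fun a => ⟨algebraMap A R a, by simp⟩)
      · intro q
        constructor
        · intro hq
          have : ∀ z, x ∣ q z := fun z => hker _ (DFunLike.congr_fun hq z)
          choose d hd using this
          classical
          refine ⟨Finsupp.onFinset q.support (fun z => if q z = 0 then 0 else d z) ?_, ?_⟩
          · intro z hz
            rw [Finsupp.mem_support_iff]
            intro h0
            simp [h0] at hz
          · ext z
            change x * (if q z = 0 then 0 else d z) = q z
            split_ifs with h0
            · rw [h0, mul_zero]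
            · exact (hd z).symm
        · rintro ⟨q, rfl⟩
          ext z
          change φ (x * q z) = 0
          rw [map_mul, hφx, zero_mul]
    let g : F →ₗ[R] N :=
      { freeCover A N with
        map_smul' := by
          intro r y
          change freeCover A N (φ r • y) = r • freeCover A N y
          rw [map_smul, hact] }
    have hg : Function.Surjective g := freeCover_surjective (R := A)
    have hK : PdLT R (LinearMap.ker g) (n + 2) :=
      PdLT.left (LinearMap.ker g).subtype g (Submodule.subtype_injective _) hg
        (LinearMap.exact_subtype_ker_map _) (hF.mono (by lia)) h
    have hK' : PdLT A (LinearMap.ker g) (n + 1) :=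
      ih (n + 1) (by lia) (fun y => Subtype.ext
        ((hFact x y).trans (by rw [hφx, zero_smul, Submodule.coe_zero]))) hK
    exact PdLT.right ((LinearMap.ker g).subtype.restrictScalars A)
      (g.restrictScalars A) (Submodule.subtype_injective _) hg
      (LinearMap.exact_subtype_ker_map g) hK' ((pdLT_one_iff.2 inferInstance).mono (by lia))

end Kill

/-! ### Square-free monomial ideals -/

section Monomial

variable {σ τ : Type u} [Finite σ] [Finite τ]

/-- The exponent vector of the square-free monomial whose set of variables is `s`. -/
noncomputable def expo (s : Set σ) : σ →₀ ℕ :=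
  Finsupp.equivFunOnFinite.symm (s.indicator 1)

open scoped Classical in
lemma expo_apply (s : Set σ) (i : σ) : expo s i = if i ∈ s then 1 else 0 := by
  simp [expo, Set.indicator_apply]

lemma expo_apply_ne_zero {s : Set σ} {i : σ} : expo s i ≠ 0 ↔ i ∈ s := by
  classical
  rw [expo_apply]; split_ifs <;> simp [*]

lemma expo_le_iff {s : Set σ} {d : σ →₀ ℕ} : expo s ≤ d ↔ ∀ i ∈ s, d i ≠ 0 := by
  classical
  rw [Finsupp.le_def]
  refine forall_congr' fun i => ?_
  rw [expo_apply]
  split_ifs with h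
  · simp [h, Nat.one_le_iff_ne_zero]
  · simp [h]

lemma expo_le_expo {s t : Set σ} : expo s ≤ expo t ↔ s ⊆ t := by
  simp only [expo_le_iff, expo_apply_ne_zero]; rfl

lemma expo_injective : Function.Injective (expo : Set σ → σ →₀ ℕ) := fun _ _ h =>
  Set.Subset.antisymm (expo_le_expo.1 h.le) (expo_le_expo.1 h.ge)

lemma expo_union {s t : Set σ} (h : Disjoint s t) : expo (s ∪ t) = expo s + expo t := by
  classical
  ext i
  rw [Finsupp.add_apply, expo_apply, expo_apply, expo_apply]
  by_cases hs : i ∈ s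
  · have : i ∉ t := Set.disjoint_left.1 h hs
    simp [hs, this]
  · simp [hs]

lemma expo_image {f : τ → σ} (hf : Function.Injective f) (s : Set τ) :
    (expo s).mapDomain f = expo (f '' s) := by
  classical
  ext i
  by_cases hi : i ∈ Set.range f
  · obtain ⟨j, rfl⟩ := hi
    rw [Finsupp.mapDomain_apply hf, expo_apply, expo_apply]
    simp [hf.eq_iff]
  · rw [Finsupp.mapDomain_of_notMem_range _ _ hi, expo_apply, if_neg]
    rintro ⟨j, -, rfl⟩
    exact hi ⟨j, rfl⟩

variable (k : Type v) [Field k]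

/-- The square-free monomial whose set of variables is `s`. -/
noncomputable def mon (s : Set σ) : MvPolynomial σ k := MvPolynomial.monomial (expo s) 1

lemma mon_union {s t : Set σ} (h : Disjoint s t) : mon k (s ∪ t) = mon k s * mon k t := by
  rw [mon, expo_union h, mon, mon, MvPolynomial.monomial_mul, one_mul]

lemma mon_dvd_mon {s t : Set σ} (h : s ⊆ t) : mon k s ∣ mon k t := by
  rw [← Set.union_sdiff_cancel h, mon_union k Set.disjoint_sdiff_right]
  exact dvd_mul_right _ _

lemma mon_singleton (i : σ) : mon k {i} = MvPolynomial.X i := by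
  classical
  rw [mon, MvPolynomial.X]
  have : expo {i} = Finsupp.single i 1 := by
    ext j
    rw [expo_apply, Finsupp.single_apply]
    simp [eq_comm]
  rw [this]

lemma rename_mon {f : τ → σ} (hf : Function.Injective f) (s : Set τ) :
    MvPolynomial.rename f (mon k s) = mon k (f '' s) := by
  rw [mon, MvPolynomial.rename_monomial, expo_image hf, mon]

/-- The square-free monomial ideal generated by the monomials of the sets of variables in `G`. -/
noncomputable def famIdeal (G : Set (Set σ)) : Ideal (MvPolynomial σ k) :=
  Ideal.span (mon k '' G)

variable {k} {G G' : Set (Set σ)}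

/-- Membership depends only on the sets of variables of the monomials that occur. -/
lemma mem_famIdeal {r : MvPolynomial σ k} :
    r ∈ famIdeal k G ↔ ∀ d ∈ r.support, ∃ s ∈ G, ∀ i ∈ s, d i ≠ 0 := by
  have : mon k '' G = (fun d => MvPolynomial.monomial d (1 : k)) '' (expo '' G) := by
    rw [Set.image_image]; rfl
  rw [famIdeal, this, MvPolynomial.mem_ideal_span_monomial_image]
  simp only [Set.exists_mem_image, expo_le_iff]

lemma mon_mem_famIdeal {s : Set σ} (hs : s ∈ G) : mon k s ∈ famIdeal k G :=
  Ideal.subset_span (Set.mem_image_of_mem _ hs)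

lemma famIdeal_le {I : Ideal (MvPolynomial σ k)} (h : ∀ s ∈ G, mon k s ∈ I) :
    famIdeal k G ≤ I :=
  Ideal.span_le.2 (Set.forall_mem_image.2 h)

lemma famIdeal_mono (h : ∀ s ∈ G, ∃ t ∈ G', t ⊆ s) : famIdeal k G ≤ famIdeal k G' :=
  famIdeal_le fun s hs =>
    let ⟨_, ht, hts⟩ := h s hs
    Ideal.mem_of_dvd _ (mon_dvd_mon k hts) (mon_mem_famIdeal ht)

lemma famIdeal_insert (s : Set σ) :
    famIdeal k (insert s G) = famIdeal k G ⊔ Ideal.span {mon k s} := by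
  rw [famIdeal, Set.image_insert_eq, Ideal.span_insert, sup_comm]; rfl

/-- The colon ideal by a square-free monomial: set its variables to `1`. -/
lemma mul_mon_mem_famIdeal (s : Set σ) (r : MvPolynomial σ k) :
    r * mon k s ∈ famIdeal k G ↔ r ∈ famIdeal k ((· \ s) '' G) := by
  rw [mem_famIdeal, mem_famIdeal]
  constructor
  · intro h d hd
    obtain ⟨t, ht, htd⟩ := h (d + expo s) (by
      rwa [MvPolynomial.mem_support_iff, mon, MvPolynomial.coeff_mul_monomial, mul_one,
        ← MvPolynomial.mem_support_iff])
    refine ⟨t \ s, ⟨t, ht, rfl⟩, fun i hi => ?_⟩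
    have h0 : expo s i = 0 := not_not.1 (mt expo_apply_ne_zero.1 hi.2)
    have := htd i hi.1
    rwa [Finsupp.add_apply, h0, add_zero] at this
  · intro h d hd
    rw [MvPolynomial.mem_support_iff, mon, MvPolynomial.coeff_mul_monomial'] at hd
    split_ifs at hd with hsd
    · rw [mul_one, ← MvPolynomial.mem_support_iff] at hd
      obtain ⟨_, ⟨t, ht, rfl⟩, htd⟩ := h _ hd
      refine ⟨t, ht, fun i hi => ?_⟩
      by_cases his : i ∈ s
      · exact expo_le_iff.1 hsd i his
      · intro h0
        exact htd i ⟨hi, his⟩ (by rw [Finsupp.tsub_apply, h0, zero_tsub])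
    · exact absurd rfl hd

end Monomial

/-! ### Setting variables to zero or one -/

section Rename

variable {k : Type v} [Field k] {σ τ : Type u}

variable (k) in
/-- The polynomial ring in the variables `σ` as an algebra over the polynomial ring in the
variables `τ`, along a map `τ → σ`. -/
noncomputable abbrev renameAlgebra (f : τ → σ) :
    Algebra (MvPolynomial τ k) (MvPolynomial σ k) :=
  (MvPolynomial.rename (R := k) f).toAlgebra

/-- A polynomial ring is free over the polynomial ring in a part of its variables. -/
lemma free_rename {f : τ → σ} (hf : Function.Injective f) :
    letI := renameAlgebra k f
    Module.Free (MvPolynomial τ k) (MvPolynomial σ k) := by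
  classical
  let e : MvPolynomial σ k ≃ₐ[k] MvPolynomial (↑(Set.range f)ᶜ) (MvPolynomial τ k) :=
    (MvPolynomial.renameEquiv k ((Equiv.Set.sumCompl (Set.range f)).symm.trans
      ((Equiv.sumComm _ _).trans (Equiv.sumCongr (Equiv.refl _)
        (Equiv.ofInjective f hf).symm)))).trans (MvPolynomial.sumAlgEquiv k _ _)
  have he : ∀ a, e (MvPolynomial.rename f a) = MvPolynomial.C a := by
    intro a
    refine DFunLike.congr_fun (f := e.toAlgHom.comp (MvPolynomial.rename f))
      (g := (IsScalarTower.toAlgHom k (MvPolynomial τ k) _)) ?_ a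
    ext i : 1
    simp only [e, AlgHom.comp_apply, MvPolynomial.rename_X]
    simp [Equiv.Set.sumCompl_symm_apply_of_mem]
  let _ := renameAlgebra k f
  let e' : MvPolynomial σ k ≃ₗ[MvPolynomial τ k]
      MvPolynomial (↑(Set.range f)ᶜ) (MvPolynomial τ k) :=
    { e with
      map_smul' := fun a r => by
        change e (MvPolynomial.rename f a * r) = a • e r
        rw [map_mul, he, MvPolynomial.smul_eq_C_mul] }
  exact Module.Free.of_equiv e'.symm

lemma map_famIdeal [Finite σ] [Finite τ] {f : τ → σ} (hf : Function.Injective f) (G : Set (Set τ)) :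
    (famIdeal k G).map (MvPolynomial.rename (R := k) f) = famIdeal k ((f '' ·) '' G) := by
  rw [famIdeal, Ideal.map_span, famIdeal, Set.image_image, Set.image_image]
  simp only [rename_mon k hf]

lemma pdLT_rename [Finite σ] [Finite τ] {f : τ → σ} (hf : Function.Injective f) {G : Set (Set τ)} {n : ℕ}
    (h : PdLT (MvPolynomial τ k) (MvPolynomial τ k ⧸ famIdeal k G) n) :
    PdLT (MvPolynomial σ k) (MvPolynomial σ k ⧸ famIdeal k ((f '' ·) '' G)) n := by
  let _ := renameAlgebra k f
  have := free_rename (k := k) hf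
  rw [← map_famIdeal hf]
  exact h.quotient_map

open scoped Classical in
/-- The evaluation that sends every variable outside the range of `f` to `c`, a left inverse of the
inclusion of polynomial rings given by `f`. -/
noncomputable def evalOutside {f : τ → σ} (hf : Function.Injective f) (c : k) :
    letI := renameAlgebra k f
    MvPolynomial σ k →ₐ[MvPolynomial τ k] MvPolynomial τ k :=
  letI := renameAlgebra k f
  { MvPolynomial.aeval (R := k) (fun i : σ => if h : i ∈ Set.range f then
      (MvPolynomial.X ((Equiv.ofInjective f hf).symm ⟨i, h⟩) : MvPolynomial τ k)
      else MvPolynomial.C c) with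
    commutes' := fun a => by
      change MvPolynomial.aeval _ (MvPolynomial.rename f a) = a
      rw [MvPolynomial.aeval_rename]
      have : ((fun i : σ => if h : i ∈ Set.range f then
          (MvPolynomial.X ((Equiv.ofInjective f hf).symm ⟨i, h⟩) : MvPolynomial τ k)
          else MvPolynomial.C c) ∘ f) = MvPolynomial.X := by
        ext1 j
        simp [Equiv.ofInjective_symm_apply]
      rw [this, MvPolynomial.aeval_X_left, AlgHom.id_apply] }

lemma evalOutside_rename {f : τ → σ} (hf : Function.Injective f) (c : k)
    (a : MvPolynomial τ k) : letI := renameAlgebra k f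
    evalOutside hf c (MvPolynomial.rename f a) = a :=
  letI := renameAlgebra k f
  (evalOutside hf c).commutes a

lemma evalOutside_X {f : τ → σ} (hf : Function.Injective f) (c : k) {i : σ}
    (hi : i ∉ Set.range f) : letI := renameAlgebra k f
    evalOutside hf c (MvPolynomial.X i) = MvPolynomial.C c := by
  change MvPolynomial.aeval _ (MvPolynomial.X i) = _
  rw [MvPolynomial.aeval_X, dif_neg hi]

lemma evalOutside_zero_mon [Finite σ] {f : τ → σ} (hf : Function.Injective f) {s : Set σ}
    (hs : ¬ s ⊆ Set.range f) : letI := renameAlgebra k f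
    evalOutside hf (0 : k) (mon k s) = 0 := by
  obtain ⟨i, his, hi⟩ := Set.not_subset.1 hs
  obtain ⟨c, hc⟩ := mon_dvd_mon k (Set.singleton_subset_iff.2 his)
  rw [hc, map_mul, mon_singleton, evalOutside_X hf 0 hi, map_zero, zero_mul]

lemma evalOutside_one_mon [Finite σ] {f : τ → σ} (hf : Function.Injective f) {s : Set σ}
    (hs : Disjoint s (Set.range f)) : letI := renameAlgebra k f
    evalOutside hf (1 : k) (mon k s) = 1 := by
  change MvPolynomial.aeval _ (MvPolynomial.monomial _ _) = _
  rw [MvPolynomial.aeval_monomial, map_one, one_mul]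
  refine Finset.prod_eq_one fun i hi => ?_
  have : i ∉ Set.range f :=
    Set.disjoint_left.1 hs (expo_apply_ne_zero.1 (Finsupp.mem_support_iff.1 hi))
  simp only [dif_neg this, map_one, one_pow]

end Rename

section ProjectiveDimension

variable (k : Type v) [Field k] {σ : Type u} [Finite σ]

/-- The projective dimension of the quotient by the square-free monomial ideal of the
family `G`. -/
noncomputable def famPd (G : Set (Set σ)) : WithBot ℕ∞ :=
  CategoryTheory.projectiveDimension
    (ModuleCat.of (MvPolynomial σ k) (MvPolynomial σ k ⧸ famIdeal k G))

variable {k} {G G' : Set (Set σ)}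

lemma famPd_lt_iff {n : ℕ} :
    famPd k G < n ↔ PdLT (MvPolynomial σ k) (MvPolynomial σ k ⧸ famIdeal k G) n :=
  CategoryTheory.projectiveDimension_lt_iff

lemma famPd_congr (h : ∀ s ∈ G, ∃ t ∈ G', t ⊆ s) (h' : ∀ s ∈ G', ∃ t ∈ G, t ⊆ s) :
    famPd k G = famPd k G' := by
  rw [famPd, famPd, le_antisymm (famIdeal_mono h) (famIdeal_mono h')]

lemma le_of_forall_natCast_lt {a b : WithBot ℕ∞} (h : ∀ n : ℕ, b < n → a < n) : a ≤ b := by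
  by_contra! hab
  induction b with
  | bot =>
    have h0 : a < (0 : ℕ) := h 0 (by simp)
    cases a with
    | bot => exact lt_irrefl _ hab
    | coe a =>
      have : (a : WithBot ℕ∞) < ((0 : ℕ∞) : WithBot ℕ∞) := h0
      simp at this
  | coe b =>
    cases b with
    | top => exact not_top_lt hab
    | coe b =>
      have h1 := h (b + 1) (by exact_mod_cast Nat.lt_succ_self b)
      have : a ≤ (b : WithBot ℕ∞) := by
        rwa [Nat.cast_add, Nat.cast_one, ENat.WithBot.lt_add_one_iff] at h1
      exact absurd hab this.not_gt

/-- The part of the family `G` avoiding the variables in `T`. -/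
def avoid (G : Set (Set σ)) (T : Set σ) : Set (Set σ) := {s ∈ G | Disjoint s T}

/-- The family obtained from `G` by setting the variables in `T` to `1`. -/
def erase (G : Set (Set σ)) (T : Set σ) : Set (Set σ) := (· \ T) '' G

/-- Additional variables that divide no generator do not matter. -/
lemma famPd_image {τ : Type u} [Finite τ] {f : τ → σ} (hf : Function.Injective f) (G : Set (Set τ)) :
    famPd k ((f '' ·) '' G) = famPd k G := by
  refine le_antisymm (le_of_forall_natCast_lt fun n h => ?_)
    (le_of_forall_natCast_lt fun n h => ?_)
  · rw [famPd_lt_iff] at h ⊢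
    exact pdLT_rename hf h
  · rw [famPd_lt_iff] at h ⊢
    let _ := renameAlgebra k f
    have := free_rename (k := k) hf
    refine PdLT.of_algebra_retraction h.restrictScalars (evalOutside hf 0) ?_ 1 (map_one _) ?_
    · refine famIdeal_le (I := (famIdeal k G).comap (evalOutside hf (0 : k))) ?_
      rintro _ ⟨s, hs, rfl⟩
      rw [Ideal.mem_comap, ← rename_mon k hf, evalOutside_rename]
      exact mon_mem_famIdeal hs
    · intro a ha
      rw [mul_one, ← map_famIdeal hf]
      exact Ideal.mem_map_of_mem _ ha

/-- `k[x_i, i ∉ T]` modulo the erased family is a retract of `R / I`, by multiplication with the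
product of the variables in `T` and evaluation of these variables at `1`. -/
lemma famPd_erase_le (G : Set (Set σ)) (T : Set σ) : famPd k (erase G T) ≤ famPd k G := by
  refine le_of_forall_natCast_lt fun n h => ?_
  rw [famPd_lt_iff] at h ⊢
  have hf : Function.Injective (Subtype.val : ↥Tᶜ → σ) := Subtype.val_injective
  let _ := renameAlgebra k (Subtype.val : ↥Tᶜ → σ)
  have := free_rename (k := k) hf
  have himg : ∀ s : Set σ, (Subtype.val '' (Subtype.val ⁻¹' s : Set ↥Tᶜ)) = s \ T := by
    intro s
    rw [Subtype.image_preimage_coe, Set.inter_comm]; rfl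
  have hG : erase G T =
      ((Subtype.val : ↥Tᶜ → σ) '' ·) '' ((fun s : Set σ => (Subtype.val ⁻¹' s)) '' G) := by
    rw [Set.image_image]
    simp only [himg]; rfl
  rw [hG]
  refine pdLT_rename hf (PdLT.of_algebra_retraction h.restrictScalars (evalOutside hf 1) ?_
    (mon k T) ?_ ?_)
  · refine famIdeal_le (I := (famIdeal k _).comap (evalOutside hf (1 : k))) fun s hs => ?_
    rw [Ideal.mem_comap, ← Set.sdiff_union_inter s T,
      mon_union k (Set.disjoint_sdiff_left.mono_right Set.inter_subset_right), ← himg,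
      ← rename_mon k hf, map_mul, evalOutside_rename]
    exact Ideal.mul_mem_right _ _ (mon_mem_famIdeal ⟨s, hs, rfl⟩)
  · refine evalOutside_one_mon hf ?_
    rw [Subtype.range_coe]
    exact disjoint_compl_right
  · suffices famIdeal k ((fun s : Set σ => (Subtype.val ⁻¹' s : Set ↥Tᶜ)) '' G) ≤
        ((famIdeal k G).colon {mon k T}).comap
          (MvPolynomial.rename (R := k) (Subtype.val : ↥Tᶜ → σ)) from
      fun a ha => Submodule.mem_colon_singleton.1 (this ha)
    refine famIdeal_le ?_
    rintro _ ⟨s, hs, rfl⟩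
    rw [Ideal.mem_comap, Submodule.mem_colon_singleton, rename_mon k hf, himg, smul_eq_mul,
      ← mon_union k Set.disjoint_sdiff_left, Set.sdiff_union_self]
    exact Ideal.mem_of_dvd _ (mon_dvd_mon k Set.subset_union_left) (mon_mem_famIdeal hs)

/-- `k[x_i, i ∉ T]` modulo the generators that avoid `T` is a retract of `R / I`, by inclusion and
evaluation of the variables in `T` at `0`. -/
lemma famPd_avoid_le (G : Set (Set σ)) (T : Set σ) : famPd k (avoid G T) ≤ famPd k G := by
  refine le_of_forall_natCast_lt fun n h => ?_
  rw [famPd_lt_iff] at h ⊢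
  have hf : Function.Injective (Subtype.val : ↥Tᶜ → σ) := Subtype.val_injective
  let _ := renameAlgebra k (Subtype.val : ↥Tᶜ → σ)
  have := free_rename (k := k) hf
  have himg : ∀ s ∈ avoid G T, (Subtype.val '' (Subtype.val ⁻¹' s : Set ↥Tᶜ)) = s := by
    rintro s ⟨-, hs⟩
    rw [Subtype.image_preimage_coe, Set.inter_comm]
    exact Set.inter_eq_left.2 (Set.subset_compl_iff_disjoint_right.2 hs)
  have hG : avoid G T = ((Subtype.val : ↥Tᶜ → σ) '' ·) ''
      ((fun s : Set σ => (Subtype.val ⁻¹' s)) '' avoid G T) := by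
    rw [Set.image_image, Set.image_congr himg, Set.image_id']
  rw [hG]
  refine pdLT_rename hf (PdLT.of_algebra_retraction h.restrictScalars (evalOutside hf 0) ?_
    1 (map_one _) ?_)
  · refine famIdeal_le (I := (famIdeal k _).comap (evalOutside hf (0 : k))) fun s hs => ?_
    rw [Ideal.mem_comap]
    by_cases hsT : Disjoint s T
    · rw [← himg s ⟨hs, hsT⟩, ← rename_mon k hf, evalOutside_rename]
      exact mon_mem_famIdeal ⟨s, ⟨hs, hsT⟩, rfl⟩
    · rw [evalOutside_zero_mon hf]
      · exact Ideal.zero_mem _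
      · rwa [Subtype.range_coe, Set.subset_compl_iff_disjoint_right]
  · suffices famIdeal k ((fun s : Set σ => (Subtype.val ⁻¹' s : Set ↥Tᶜ)) '' avoid G T) ≤
        (famIdeal k G).comap (MvPolynomial.rename (R := k) (Subtype.val : ↥Tᶜ → σ)) from
      fun a ha => by rw [mul_one]; exact this ha
    refine famIdeal_le ?_
    rintro _ ⟨s, hs, rfl⟩
    rw [Ideal.mem_comap, rename_mon k hf, himg s hs]
    exact mon_mem_famIdeal hs.1

end ProjectiveDimension

/-! ### Splitting off a variable or a generator -/

section Variable

variable {k : Type v} [Field k] {σ τ : Type u}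

lemma X_dvd_of_evalOutside_eq_zero {f : τ → σ} (hf : Function.Injective f) {i : σ}
    (hi : Set.range f = {i}ᶜ) {r : MvPolynomial σ k} (hr : evalOutside hf (0 : k) r = 0) :
    MvPolynomial.X i ∣ r := by
  let _ := renameAlgebra k f
  have key : ((Ideal.Quotient.mk (Ideal.span {(MvPolynomial.X i : MvPolynomial σ k)})).comp
      (MvPolynomial.rename (R := k) f : MvPolynomial τ k →+* MvPolynomial σ k)).comp
      (evalOutside hf (0 : k) : MvPolynomial σ k →+* MvPolynomial τ k) =
      Ideal.Quotient.mk (Ideal.span {(MvPolynomial.X i : MvPolynomial σ k)}) := by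
    refine MvPolynomial.ringHom_ext (fun c => ?_) (fun j => ?_)
    · have : (MvPolynomial.C c : MvPolynomial σ k) =
        MvPolynomial.rename f (MvPolynomial.C c : MvPolynomial τ k) := by simp
      change Ideal.Quotient.mk _ (MvPolynomial.rename f (evalOutside hf (0 : k) _)) = _
      rw [this, evalOutside_rename]
    · change Ideal.Quotient.mk _ (MvPolynomial.rename f (evalOutside hf (0 : k) _)) = _
      by_cases hj : j ∈ Set.range f
      · obtain ⟨j, rfl⟩ := hj
        rw [← MvPolynomial.rename_X (R := k) f, evalOutside_rename]
      · rw [evalOutside_X hf 0 hj, map_zero, map_zero, map_zero, eq_comm,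
          Ideal.Quotient.eq_zero_iff_mem]
        rw [hi, Set.mem_compl_iff, not_not, Set.mem_singleton_iff] at hj
        rw [hj]
        exact Ideal.mem_span_singleton_self _
  have h := DFunLike.congr_fun key r
  change Ideal.Quotient.mk _ (MvPolynomial.rename f (evalOutside hf (0 : k) r)) = _ at h
  rw [hr, map_zero, map_zero, eq_comm, Ideal.Quotient.eq_zero_iff_mem,
    Ideal.mem_span_singleton] at h
  exact h

lemma pderiv_rename_eq_zero {f : τ → σ} {i : σ} (hi : i ∉ Set.range f) (a : MvPolynomial τ k) :
    MvPolynomial.pderiv i (MvPolynomial.rename f a) = 0 := by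
  classical
  refine MvPolynomial.pderiv_eq_zero_of_notMem_vars fun hv => hi ?_
  obtain ⟨j, -, hj⟩ := Finset.mem_image.1 (MvPolynomial.vars_rename _ _ hv)
  exact ⟨j, hj⟩

/-- Dropping the variable `X i` from the polynomial ring lowers the projective dimension of a
quotient in which `X i` vanishes. -/
lemma pdLT_of_X_mem {f : τ → σ} (hf : Function.Injective f) {i : σ}
    (hi : Set.range f = {i}ᶜ) {J : Ideal (MvPolynomial σ k)} (hX : MvPolynomial.X i ∈ J) {n : ℕ}
    (h : PdLT (MvPolynomial σ k) (MvPolynomial σ k ⧸ J) (n + 1)) :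
    letI := renameAlgebra k f
    PdLT (MvPolynomial τ k) (MvPolynomial σ k ⧸ J) n := by
  let _ := renameAlgebra k f
  have := free_rename (k := k) hf
  have hir : i ∉ Set.range f := by rw [hi]; exact fun h => h rfl
  have hφx : evalOutside hf (0 : k) (MvPolynomial.X i) = 0 :=
    (evalOutside_X hf 0 hir).trans (map_zero _)
  -- the coefficient of `X i`
  let δ : MvPolynomial σ k →ₗ[MvPolynomial τ k] MvPolynomial τ k :=
    { toFun := fun r => evalOutside hf (0 : k) (MvPolynomial.pderiv i r)
      map_add' := fun r r' => by rw [map_add, map_add]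
      map_smul' := fun a r => by
        have : a • r = MvPolynomial.rename f a * r := rfl
        rw [this, Derivation.leibniz, pderiv_rename_eq_zero hir, smul_zero, add_zero, smul_eq_mul,
          map_mul, evalOutside_rename]
        rfl }
  have hδ : ∀ r, δ (MvPolynomial.X i * r) = evalOutside hf (0 : k) r := by
    intro r
    change evalOutside hf (0 : k) (MvPolynomial.pderiv i (MvPolynomial.X i * r)) = _
    rw [Derivation.leibniz, MvPolynomial.pderiv_X_self, smul_eq_mul, smul_eq_mul, map_add,
      map_mul, hφx, zero_mul, zero_add, mul_one]
  refine PdLT.of_smul_eq_zero (MvPolynomial.X i) (evalOutside hf 0) hφx δ hδ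
    (fun r hr => X_dvd_of_evalOutside_eq_zero hf hi hr)
    (fun r hr => (mul_eq_zero.1 hr).resolve_left (MvPolynomial.X_ne_zero i)) (fun y => ?_) h
  obtain ⟨r, rfl⟩ := Ideal.Quotient.mk_surjective y
  change Ideal.Quotient.mk J (MvPolynomial.X i * r) = 0
  rw [Ideal.Quotient.eq_zero_iff_mem]
  exact Ideal.mul_mem_right _ _ hX

end Variable

section Inequalities

variable {k : Type v} [Field k] {σ : Type u} [Finite σ] {G : Set (Set σ)}

/-- From the exact sequence `0 → R / (I : m) → R / I → R / (I + (m)) → 0`. -/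
lemma famPd_le_max_erase_insert (G : Set (Set σ)) (s : Set σ) :
    famPd k G ≤ max (famPd k (erase G s)) (famPd k (insert s G)) := by
  refine le_of_forall_natCast_lt fun n h => ?_
  rw [max_lt_iff, famPd_lt_iff, famPd_lt_iff] at h
  rw [famPd_lt_iff]
  exact PdLT.of_colon (mul_mon_mem_famIdeal s) (famIdeal_insert s) h.1 h.2

lemma add_one_lt_succ_iff {a : WithBot ℕ∞} {n : ℕ} : a + 1 < ((n + 1 : ℕ) : WithBot ℕ∞) ↔
    a < n := by
  rw [← not_le, ← not_le, Nat.cast_add, Nat.cast_one, ENat.WithBot.add_le_add_one_right_iff]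

/-- From the exact sequence `0 → R / (I : m) → R / I → R / (I + (m)) → 0`. -/
lemma famPd_insert_le_max (G : Set (Set σ)) (s : Set σ) :
    famPd k (insert s G) ≤ max (famPd k G) (famPd k (erase G s) + 1) := by
  refine le_of_forall_natCast_lt fun n h => ?_
  rw [max_lt_iff] at h
  cases n with
  | zero =>
    have h0 := h.1
    rw [famPd_lt_iff, pdLT_zero_iff, Ideal.Quotient.subsingleton_iff] at h0 ⊢
    rw [famIdeal_insert, h0, top_sup_eq]
  | succ n =>
    rw [add_one_lt_succ_iff, famPd_lt_iff, famPd_lt_iff] at h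
    rw [famPd_lt_iff]
    exact PdLT.of_sup_span (mul_mon_mem_famIdeal s) (famIdeal_insert s) h.2 h.1

lemma famPd_insert_le (G : Set (Set σ)) (s : Set σ) :
    famPd k (insert s G) ≤ famPd k G + 1 := by
  refine (famPd_insert_le_max G s).trans (max_le ?_ ?_)
  · exact le_add_of_nonneg_right zero_le_one
  · gcongr
    exact famPd_erase_le G s

lemma famPd_le_max_erase_avoid (G : Set (Set σ)) (i : σ) :
    famPd k G ≤ max (famPd k (erase G {i})) (famPd k (avoid G {i}) + 1) := by
  refine (famPd_le_max_erase_insert G {i}).trans (max_le_max le_rfl ?_)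
  refine le_trans (le_of_eq ?_) (famPd_insert_le (avoid G {i}) {i})
  refine famPd_congr ?_ ?_
  · rintro s (rfl | hs)
    · exact ⟨_, Set.mem_insert _ _, subset_rfl⟩
    · by_cases his : i ∈ s
      · exact ⟨{i}, Set.mem_insert _ _, Set.singleton_subset_iff.2 his⟩
      · exact ⟨s, Or.inr ⟨hs, Set.disjoint_singleton_right.2 his⟩, subset_rfl⟩
  · rintro s (rfl | hs)
    · exact ⟨_, Set.mem_insert _ _, subset_rfl⟩
    · exact ⟨s, Or.inr hs.1, subset_rfl⟩

/-- A variable that divides no generator raises the projective dimension by one (at least, and by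
`famPd_insert_le` exactly) when it is added to the ideal. -/
lemma famPd_add_one_le (G : Set (Set σ)) (i : σ) (hi : ∀ s ∈ G, i ∉ s) :
    famPd k G + 1 ≤ famPd k (insert {i} G) := by
  classical
  have key : ∀ n : ℕ, famPd k (insert {i} G) < (n + 1 : ℕ) → famPd k G < n := by
    intro n h
    rw [famPd_lt_iff] at h ⊢
    have hf : Function.Injective (Subtype.val : ↥({i}ᶜ : Set σ) → σ) := Subtype.val_injective
    let _ := renameAlgebra k (Subtype.val : ↥({i}ᶜ : Set σ) → σ)
    have := free_rename (k := k) hf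
    have hX : (MvPolynomial.X i : MvPolynomial σ k) ∈ famIdeal k (insert {i} G) := by
      rw [← mon_singleton]
      exact mon_mem_famIdeal (Set.mem_insert _ _)
    have hA := pdLT_of_X_mem hf Subtype.range_coe hX h
    have himg : ∀ s ∈ G,
        (Subtype.val '' (Subtype.val ⁻¹' s : Set ↥({i}ᶜ : Set σ))) = s := by
      intro s hs
      rw [Subtype.image_preimage_coe, Set.inter_comm]
      exact Set.inter_eq_left.2 (Set.subset_compl_singleton_iff.2 (hi s hs))
    have hG : G = ((Subtype.val : ↥({i}ᶜ : Set σ) → σ) '' ·) ''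
        ((fun s : Set σ => (Subtype.val ⁻¹' s)) '' G) := by
      rw [Set.image_image, Set.image_congr himg, Set.image_id']
    rw [hG]
    refine pdLT_rename hf
      (PdLT.of_algebra_retraction hA (evalOutside hf 0) ?_ 1 (map_one _) ?_)
    · refine famIdeal_le (I := (famIdeal k _).comap (evalOutside hf (0 : k))) fun s hs => ?_
      rw [Ideal.mem_comap]
      rcases hs with rfl | hs
      · rw [evalOutside_zero_mon hf (by simp)]
        exact Ideal.zero_mem _
      · rw [← himg s hs, ← rename_mon k hf, evalOutside_rename]
        exact mon_mem_famIdeal ⟨s, hs, rfl⟩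
    · suffices famIdeal k ((fun s : Set σ => (Subtype.val ⁻¹' s : Set ↥({i}ᶜ : Set σ))) '' G) ≤
          (famIdeal k (insert {i} G)).comap
            (MvPolynomial.rename (R := k) (Subtype.val : ↥({i}ᶜ : Set σ) → σ)) from
        fun a ha => by rw [mul_one]; exact this ha
      refine famIdeal_le ?_
      rintro _ ⟨s, hs, rfl⟩
      rw [Ideal.mem_comap, rename_mon k hf, himg s hs]
      exact mon_mem_famIdeal (Or.inr hs)
  refine le_of_forall_natCast_lt fun n h => ?_
  cases n with
  | zero =>
    have : famPd k G < (0 : ℕ) := key 0 (h.trans (by norm_num))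
    have hbot : famPd k G = ⊥ := by
      rwa [← ENat.WithBot.add_one_le_natCast_iff, Nat.cast_zero,
        ENat.WithBot.add_one_le_zero_iff] at this
    rw [hbot, WithBot.bot_add]
    exact WithBot.bot_lt_coe _
  | succ n => exact add_one_lt_succ_iff.2 (key n h)

/-- Adding the monomial `m` to an ideal does not lower the projective dimension, if some variable
`x_i` of `m` divides at most one generator. By `famPd_le_max_erase_insert` it suffices to bound the
family with the variables of `m` erased. The generator through `i` contributes at most one to its
projective dimension, and so does, exactly, the variable `x_i` that `m` becomes when its other
variables are set to `1`. -/
lemma famPd_le_insert (G : Set (Set σ)) (m : Set σ) {i : σ} (him : i ∈ m)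
    (hi : ∀ s ∈ G, ∀ t ∈ G, i ∈ s → i ∈ t → s = t) :
    famPd k G ≤ famPd k (insert m G) := by
  refine (famPd_le_max_erase_insert G m).trans (max_le ?_ le_rfl)
  have hle : famPd k (insert {i} (erase (avoid G {i}) m)) ≤ famPd k (insert m G) := by
    refine le_trans (le_of_eq ?_) (famPd_erase_le (insert m G) (m \ {i}))
    refine famPd_congr ?_ ?_
    · rintro s (rfl | ⟨t, ⟨ht, hit⟩, rfl⟩)
      · refine ⟨_, ⟨m, Set.mem_insert _ _, rfl⟩, ?_⟩
        intro j hj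
        by_contra hne
        exact hj.2 ⟨hj.1, hne⟩
      · refine ⟨_, ⟨t, Or.inr ht, rfl⟩, ?_⟩
        rintro j ⟨hjt, hj⟩
        refine ⟨hjt, fun hjm => hj ⟨hjm, ?_⟩⟩
        rintro rfl
        exact Set.disjoint_singleton_right.1 hit hjt
    · rintro _ ⟨s, rfl | hs, rfl⟩
      · refine ⟨{i}, Set.mem_insert _ _, ?_⟩
        rw [Set.singleton_subset_iff]
        exact ⟨him, fun h => h.2 rfl⟩
      · by_cases his : i ∈ s
        · refine ⟨{i}, Set.mem_insert _ _, ?_⟩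
          rw [Set.singleton_subset_iff]
          exact ⟨his, fun h => h.2 rfl⟩
        · exact ⟨s \ m, Or.inr ⟨s, ⟨hs, Set.disjoint_singleton_right.2 his⟩, rfl⟩,
            Set.sdiff_subset_sdiff_right Set.sdiff_subset⟩
  refine le_trans ?_ hle
  have h4 : famPd k (erase (avoid G {i}) m) + 1 ≤
      famPd k (insert {i} (erase (avoid G {i}) m)) := by
    refine famPd_add_one_le _ _ ?_
    rintro _ ⟨t, ⟨-, hit⟩, rfl⟩ h
    exact Set.disjoint_singleton_right.1 hit h.1
  refine le_trans ?_ h4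
  by_cases hex : ∃ s ∈ G, i ∈ s
  · obtain ⟨s, hs, his⟩ := hex
    refine le_trans (le_of_eq ?_) (famPd_insert_le (erase (avoid G {i}) m) (s \ m))
    congr 1
    ext t
    constructor
    · rintro ⟨t, ht, rfl⟩
      by_cases hit : i ∈ t
      · exact Or.inl (by rw [hi t ht s hs hit his])
      · exact Or.inr ⟨t, ⟨ht, Set.disjoint_singleton_right.2 hit⟩, rfl⟩
    · rintro (rfl | ⟨t, ht, rfl⟩)
      · exact ⟨s, hs, rfl⟩
      · exact ⟨t, ht.1, rfl⟩
  · push Not at hex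
    have : avoid G {i} = G :=
      Set.ext fun t => ⟨fun h => h.1, fun h => ⟨h, Set.disjoint_singleton_right.2 (hex t h)⟩⟩
    rw [this]
    exact le_add_of_nonneg_right zero_le_one

end Inequalities

/-! ### Variables that divide the same generators -/

section Collapse

variable {k : Type v} [Field k] {σ : Type u} {G : Set (Set σ)}

lemma erase_eq_self {T : Set σ} (h : ∀ s ∈ G, Disjoint s T) : erase G T = G := by
  rw [erase, Set.image_congr fun s hs => (h s hs).sdiff_eq_left, Set.image_id']

lemma erase_erase (G : Set (Set σ)) (S T : Set σ) : erase (erase G S) T = erase G (S ∪ T) := by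
  rw [erase, erase, erase, Set.image_image]
  simp only [Set.sdiff_sdiff]

variable [Finite σ]

/-- A variable with a twin that divides at most one of the generators can be set to `1`: if that
generator is `s`, both sides are the maximum of the projective dimensions of the other generators
and of the other generators with `s` erased, the latter plus one. -/
lemma famPd_erase_singleton {i j : σ} (hij : i ≠ j) (htwin : ∀ s ∈ G, i ∈ s ↔ j ∈ s)
    (hj : ∀ s ∈ G, ∀ t ∈ G, j ∈ s → j ∈ t → s = t) :
    famPd k (erase G {j}) = famPd k G := by
  refine le_antisymm (famPd_erase_le G {j}) ?_
  by_cases hex : ∃ s ∈ G, j ∈ s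
  · obtain ⟨s, hs, hjs⟩ := hex
    have his : i ∈ s := (htwin s hs).2 hjs
    have hG : G = insert s (avoid G {j}) := by
      ext t
      constructor
      · intro ht
        by_cases hjt : j ∈ t
        · exact Or.inl (hj t ht s hs hjt hjs)
        · exact Or.inr ⟨ht, Set.disjoint_singleton_right.2 hjt⟩
      · rintro (rfl | ht)
        · exact hs
        · exact ht.1
    have hit : ∀ t ∈ avoid G {j}, i ∉ t := fun t ht hit =>
      Set.disjoint_singleton_right.1 ht.2 ((htwin t ht.1).1 hit)
    have hle : famPd k G ≤ max (famPd k (avoid G {j})) (famPd k (erase (avoid G {j}) s) + 1) :=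
      (congrArg (famPd k) hG).le.trans (famPd_insert_le_max _ _)
    refine hle.trans (max_le ?_ ?_)
    · refine le_trans (le_of_eq ?_) (famPd_avoid_le (erase G {j}) {i})
      congr 1
      ext t
      constructor
      · intro ht
        exact ⟨⟨t, ht.1, ht.2.sdiff_eq_left⟩, Set.disjoint_singleton_right.2 (hit t ht)⟩
      · rintro ⟨⟨t, ht, rfl⟩, hd⟩
        have hjt : j ∉ t := fun hjt =>
          Set.disjoint_singleton_right.1 hd ⟨(htwin t ht).2 hjt, hij⟩
        have := Set.disjoint_singleton_right.2 hjt
        change t \ {j} ∈ _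
        rw [this.sdiff_eq_left]
        exact ⟨ht, this⟩
    · refine (famPd_add_one_le (erase (avoid G {j}) s) i ?_).trans ?_
      · rintro _ ⟨t, ht, rfl⟩ h
        exact hit t ht h.1
      · refine le_trans (le_of_eq ?_) (famPd_erase_le (erase G {j}) (s \ {i}))
        have h1 : (s \ {j}) \ (s \ {i}) = {i} := by
          ext l
          constructor
          · rintro ⟨⟨hl, -⟩, hl'⟩
            by_contra hne
            exact hl' ⟨hl, hne⟩
          · rintro rfl
            exact ⟨⟨his, hij⟩, fun h => h.2 rfl⟩
        have h2 : ∀ t ∈ avoid G {j}, (t \ {j}) \ (s \ {i}) = t \ s := by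
          intro t ht
          rw [ht.2.sdiff_eq_left]
          ext l
          refine and_congr_right fun hl => not_congr ⟨fun h => h.1, fun h => ⟨h, ?_⟩⟩
          rintro rfl
          exact hit t ht hl
        conv_rhs => rw [hG]
        congr 1
        rw [erase, erase, erase, Set.image_insert_eq, Set.image_insert_eq, h1, Set.image_image,
          Set.image_congr h2]
  · push Not at hex
    exact (congrArg (famPd k)
      (erase_eq_self fun s hs => Set.disjoint_singleton_right.2 (hex s hs))).ge

/-- Version of `famPd_erase_singleton` for a set `T` of variables with twins outside of `T`. -/
lemma famPd_erase_twins (T : Set σ)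
    (h : ∀ j ∈ T, ∃ i ∉ T, (∀ s ∈ G, i ∈ s ↔ j ∈ s) ∧
      ∀ s ∈ G, ∀ t ∈ G, j ∈ s → j ∈ t → s = t) :
    famPd k (erase G T) = famPd k G := by
  induction T, T.toFinite using Set.Finite.induction_on with
  | empty => rw [erase_eq_self fun s _ => Set.disjoint_empty s]
  | @insert j T hjT _ ih =>
    rw [Set.insert_eq, Set.union_comm, ← erase_erase]
    obtain ⟨i, hi, htwin, hj⟩ := h j (Set.mem_insert _ _)
    rw [famPd_erase_singleton (i := i)]
    · refine ih fun l hl => ?_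
      obtain ⟨i, hi, h'⟩ := h l (Or.inr hl)
      exact ⟨i, fun h => hi (Or.inr h), h'⟩
    · rintro rfl
      exact hi (Set.mem_insert _ _)
    · rintro _ ⟨s, hs, rfl⟩
      exact and_congr (htwin s hs) (iff_of_true (fun h => hi (Or.inr h)) hjT)
    · rintro _ ⟨s, hs, rfl⟩ _ ⟨t, ht, rfl⟩ hjs hjt
      rw [hj s hs t ht hjs.1 hjt.1]

/-- Replacing each variable `t` by the product of the variables in its fibre under `f` keeps the
projective dimension, if the variables with nontrivial fibre divide at most one generator each. -/
lemma famPd_preimage {τ : Type u} [Finite τ] {f : σ → τ} (hf : Function.Surjective f)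
    (G : Set (Set τ))
    (h : ∀ i j, f i = f j → i ≠ j → ∀ s ∈ G, ∀ t ∈ G, f i ∈ s → f i ∈ t → s = t) :
    famPd k ((f ⁻¹' ·) '' G) = famPd k G := by
  obtain ⟨g, hg⟩ := hf.hasRightInverse
  rw [← famPd_erase_twins (Set.range g)ᶜ, ← famPd_image hg.injective G]
  · congr 1
    rw [erase, Set.image_image]
    refine Set.image_congr fun s _ => ?_
    ext i
    constructor
    · rintro ⟨his, hi⟩
      obtain ⟨t, rfl⟩ := not_not.1 hi
      exact ⟨t, by rwa [Set.mem_preimage, hg] at his, rfl⟩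
    · rintro ⟨t, ht, rfl⟩
      exact ⟨by rwa [Set.mem_preimage, hg], fun h => h ⟨t, rfl⟩⟩
  · intro j hj
    refine ⟨g (f j), fun h => h ⟨_, rfl⟩, ?_, ?_⟩
    · rintro _ ⟨s, -, rfl⟩
      rw [Set.mem_preimage, Set.mem_preimage, hg]
    · rintro _ ⟨s, hs, rfl⟩ _ ⟨t, ht, rfl⟩ hjs hjt
      rw [h j (g (f j)) (hg _).symm (fun h => hj ⟨_, h.symm⟩) s hs t ht hjs hjt]

end Collapse

/-! ### The square-free ideal of a hypergraph -/

section Star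

variable (k : Type v) [Field k]

lemma X_dvd_mon_iff {σ : Type u} [Finite σ] {i : σ} {s : Set σ} :
    (MvPolynomial.X i : MvPolynomial σ k) ∣ mon k s ↔ i ∈ s := by
  rw [← mon_singleton]
  refine ⟨fun h => ?_, fun h => mon_dvd_mon k (Set.singleton_subset_iff.2 h)⟩
  rw [mon, mon, MvPolynomial.monomial_dvd_monomial, expo_le_expo] at h
  exact Set.singleton_subset_iff.1 (h.1.resolve_left one_ne_zero)

variable {V : Type u}

/-- The set of faces through the vertex `a`, that is, of the variables dividing `m_a`. -/
def star (H : Set (Set V)) (a : V) : Set H := {F | a ∈ F.1}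

lemma mem_star {H : Set (Set V)} {a : V} {F : H} : F ∈ star H a ↔ a ∈ F.1 := Iff.rfl

lemma vertexMonomial_eq_mon [Finite V] (H : Set (Set V)) (a : V) :
    vertexMonomial k H a = mon k (star H a) := by
  classical
  have _ : Fintype H := Fintype.ofFinite H
  have h1 : vertexMonomial k H a = ∏ F : H, if F ∈ star H a then MvPolynomial.X F else 1 := by
    rw [← finprod_eq_prod_of_fintype]
    exact finprod_congr fun F => finprod_eq_if
  rw [h1, mon, MvPolynomial.monomial_eq, map_one, one_mul, Finsupp.prod_fintype _ _ (by simp)]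
  refine Finset.prod_congr rfl fun F _ => ?_
  rw [expo_apply]
  split_ifs <;> simp

lemma standardIdeal_eq [Finite V] (H : Set (Set V)) :
    standardIdeal k H = famIdeal k (Set.range (star H)) := by
  rw [standardIdeal, famIdeal, ← Set.range_comp]
  congr 2
  exact funext (vertexMonomial_eq_mon k H)

lemma pd_eq_famPd [Finite V] (H : Set (Set V)) :
    pd k H = famPd k (Set.range (star H)) := by
  rw [pd, famPd, standardIdeal_eq]

/-- The hypergraph of a family of square-free monomials has the projective dimension of the ideal
they generate. Variables that divide the same monomials give the same face, which is harmless if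
they divide at most one of them. -/
lemma pd_hypergraphOfMonomials {σ ι : Type u} [Finite σ] [Finite ι] (s : ι → Set σ)
    (h : ∀ i j, i ≠ j → (∀ a, i ∈ s a ↔ j ∈ s a) → ∀ a b, i ∈ s a → i ∈ s b → a = b) :
    pd k (hypergraphOfMonomials fun a => mon k (s a)) = famPd k (Set.range s) := by
  set H := hypergraphOfMonomials fun a => mon k (s a) with hH
  let f : σ → H := fun i => ⟨_, Set.mem_range_self i⟩
  have hf : Function.Surjective f := by
    rintro ⟨_, i, rfl⟩
    exact ⟨i, rfl⟩
  have hfs : ∀ i a, a ∈ (f i).1 ↔ i ∈ s a := fun i a => X_dvd_mon_iff k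
  have hpre : ∀ a, f ⁻¹' star H a = s a := fun a => Set.ext fun i => hfs i a
  rw [pd_eq_famPd, ← famPd_preimage hf, ← Set.range_comp]
  · congr 2
    exact funext hpre
  · rintro i j hij hne _ ⟨a, rfl⟩ _ ⟨b, rfl⟩ ha hb
    rw [h i j hne (fun a => by rw [← hfs, ← hfs, hij]) a b ((hfs i a).1 ha) ((hfs i b).1 hb)]

lemma minGens_famIdeal {σ : Type u} [Finite σ] {G : Set (Set σ)}
    (hG : ∀ s ∈ G, ∀ t ∈ G, s ⊆ t → s = t) : minGens (famIdeal k G) = expo '' G := by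
  have hmem : ∀ d : σ →₀ ℕ, MvPolynomial.monomial d (1 : k) ∈ famIdeal k G ↔
      ∃ s ∈ G, expo s ≤ d := by
    intro d
    rw [mem_famIdeal]
    classical
    simp [MvPolynomial.support_monomial, expo_le_iff]
  ext d
  constructor
  · rintro ⟨hd, hmin⟩
    obtain ⟨s, hs, hsd⟩ := (hmem d).1 hd
    exact ⟨s, hs, le_antisymm hsd (hmin ((hmem _).2 ⟨s, hs, le_rfl⟩) hsd)⟩
  · rintro ⟨s, hs, rfl⟩
    refine ⟨(hmem _).2 ⟨s, hs, le_rfl⟩, fun d hd hds => ?_⟩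
    obtain ⟨t, ht, htd⟩ := (hmem d).1 hd
    rwa [← hG t ht s hs (expo_le_expo.1 (htd.trans hds))]

lemma pd_hypergraphOfIdeal {σ : Type u} [Finite σ] {G : Set (Set σ)}
    (hG : ∀ s ∈ G, ∀ t ∈ G, s ⊆ t → s = t)
    (h : ∀ i j, i ≠ j → (∀ s ∈ G, i ∈ s ↔ j ∈ s) → ∀ s ∈ G, ∀ t ∈ G, i ∈ s → i ∈ t → s = t) :
    pd k (hypergraphOfIdeal (famIdeal k G)) = famPd k G := by
  have hmin := minGens_famIdeal k hG
  have : Finite (minGens (famIdeal k G)) := by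
    rw [hmin]
    exact (Set.toFinite (expo '' G)).to_subtype
  have hd : ∀ d : minGens (famIdeal k G), ∃ s ∈ G, expo s = d := fun d =>
    hmin.le d.2
  choose s hs hsd using hd
  have heq : hypergraphOfIdeal (famIdeal k G) = hypergraphOfMonomials fun d => mon k (s d) := by
    rw [hypergraphOfIdeal]
    congr 1
    ext1 d
    rw [mon, hsd]
  have hrange : Set.range s = G := by
    refine Set.Subset.antisymm (Set.range_subset_iff.2 hs) fun t ht => ?_
    have ht' : expo t ∈ minGens (famIdeal k G) := by
      rw [hmin]
      exact ⟨t, ht, rfl⟩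
    exact ⟨⟨_, ht'⟩, expo_injective (hsd ⟨_, ht'⟩)⟩
  rw [heq, pd_hypergraphOfMonomials, hrange]
  intro i j hij htwin a b ha hb
  have := h i j hij (fun t ht => by
    obtain ⟨d, rfl⟩ := hrange.ge ht
    exact htwin d) _ (hs a) _ (hs b) ha hb
  exact Subtype.ext (by rw [← hsd a, ← hsd b, this])

end Star

/-! ### Removal and cancellation in dimension one -/

section OneDimensional

variable {V : Type u} {H : Set (Set V)}

lemma OneDimensional.eq_pair (hdim : OneDimensional H) {F : Set V} (hF : F ∈ H) {a b : V}
    (ha : a ∈ F) (hb : b ∈ F) (hab : a ≠ b) : F = {a, b} := by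
  refine ((Set.toFinite {a, b}).eq_of_subset_of_encard_le ?_ ?_).symm
  · rintro x (rfl | rfl) <;> assumption
  · rw [Set.encard_pair hab]
    exact hdim.1 F hF

/-- The faces `{v}` and `{v, w}` of `H` give the same face of `H_w`, but no generator other than
`m_v` is divisible by the two variables, so that `pd_hypergraphOfMonomials` applies. -/
lemma pd_remove (k : Type v) [Field k] [Finite V] (hdim : OneDimensional H) (w : V) :
    pd k (remove H w) = famPd k (star H '' {w}ᶜ) := by
  rw [← hypergraphOfMonomials_removed k]
  simp only [vertexMonomial_eq_mon]
  rw [pd_hypergraphOfMonomials k (fun a : {a // a ≠ w} => star H a)]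
  · congr 1
    ext s
    simp
  · intro i j hij htwin a b ha hb
    by_contra hab
    have hab' : (a : V) ≠ b := fun h => hab (Subtype.ext h)
    refine hij (Subtype.ext ?_)
    rw [hdim.eq_pair i.2 ha hb hab',
      hdim.eq_pair j.2 ((htwin a).1 ha) ((htwin b).1 hb) hab']

/-- The hypothesis says that the generators `m_a`, with `x_E` set to `1`, stay minimal. -/
lemma pd_cancel (k : Type v) [Field k] [Finite V] (E : H)
    (h : ∀ a b, star H a \ {E} ⊆ star H b → a = b) :
    pd k (cancel k H E) = famPd k (erase (Set.range (star H)) {E}) := by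
  have hcolon : (standardIdeal k H).colon {(MvPolynomial.X E : MvPolynomial H k)} =
      famIdeal k (erase (Set.range (star H)) {E}) := by
    ext r
    rw [Submodule.mem_colon_singleton, standardIdeal_eq, smul_eq_mul, ← mon_singleton]
    exact mul_mon_mem_famIdeal {E} r
  rw [cancel, hcolon]
  refine pd_hypergraphOfIdeal k ?_ ?_
  · rintro _ ⟨_, ⟨a, rfl⟩, rfl⟩ _ ⟨_, ⟨b, rfl⟩, rfl⟩ hab
    rw [h a b (hab.trans Set.sdiff_subset)]
  · rintro i j hij htwin _ ⟨_, ⟨a, rfl⟩, rfl⟩ _ ⟨_, ⟨b, rfl⟩, rfl⟩ ha hb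
    have hjE : j ≠ E := ((htwin _ ⟨_, ⟨a, rfl⟩, rfl⟩).1 ha).2
    refine absurd (Subtype.ext (Set.ext fun c => ?_)) hij
    have hc := htwin _ ⟨_, ⟨c, rfl⟩, rfl⟩
    exact ⟨fun h => (hc.1 ⟨h, ha.2⟩).1, fun h => (hc.2 ⟨h, hjE⟩).1⟩

end OneDimensional

/-! ### Branches -/

section Branch

variable {V : Type u} {H : Set (Set V)} {w : V} {S : Set V}

lemma IsBranch.notMem (hS : IsBranch H w S) : w ∉ S := by
  obtain ⟨C, rfl, -⟩ := hS
  rintro ⟨a, -, ha⟩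
  exact a.2 ha

/-- A vertex other than `w` that shares a face with a vertex of the branch is on the branch. -/
lemma IsBranch.mem_of_face (hS : IsBranch H w S) {a b : V} (ha : a ∈ S) (hb : b ≠ w)
    {F : Set V} (hF : F ∈ H) (haF : a ∈ F) (hbF : b ∈ F) : b ∈ S := by
  by_cases hab : a = b
  · rwa [← hab]
  obtain ⟨C, rfl, -⟩ := hS
  obtain ⟨a, haC, rfl⟩ := ha
  refine ⟨⟨b, hb⟩, ?_, rfl⟩
  refine C.mem_supp_of_adj_mem_supp haC ⟨fun h => hab (congrArg Subtype.val h), ?_⟩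
  exact ⟨_, ⟨F, hF, rfl⟩, haF, hbF⟩

/-- A branch is connected: a vertex of a branch with several vertices has a neighbor on it. -/
lemma IsBranch.exists_face (hS : IsBranch H w S) {a b : V} (ha : a ∈ S) (hb : b ∈ S)
    (hab : a ≠ b) : ∃ c ∈ S, c ≠ a ∧ ∃ F ∈ H, a ∈ F ∧ c ∈ F := by
  obtain ⟨C, rfl, -⟩ := hS
  obtain ⟨a, haC, rfl⟩ := ha
  obtain ⟨b, hbC, rfl⟩ := hb
  have hr : (neighborGraph (remove H w)).Reachable a b := C.reachable_of_mem_supp haC hbC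
  obtain ⟨p⟩ := hr
  cases p with
  | nil => exact absurd rfl hab
  | @cons _ c _ hadj _ =>
    obtain ⟨hne, _, ⟨F, hF, rfl⟩, haF, hcF⟩ := id hadj
    exact ⟨c, ⟨c, C.mem_supp_of_adj_mem_supp haC hadj, rfl⟩,
      fun h => hne (Subtype.ext h.symm), F, hF, haF, hcF⟩

lemma IsJoint.exists_face (hw : IsJoint H w) (x y : V) :
    ∃ z, z ≠ w ∧ z ≠ x ∧ z ≠ y ∧ ∃ F ∈ H, w ∈ F ∧ z ∈ F := by
  have hlt : ({x, y} : Set V).encard < ((neighborGraph H).neighborSet w).encard :=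
    lt_of_lt_of_le (lt_of_le_of_lt (Set.encard_insert_le {y} x) (by
      rw [Set.encard_singleton]; norm_num)) hw
  obtain ⟨z, hz, hzxy⟩ := Set.not_subset.1 fun hsub => hlt.not_ge (Set.encard_le_encard hsub)
  obtain ⟨hne, F, hF⟩ := hz
  exact ⟨z, hne.symm, fun h => hzxy (Or.inl h), fun h => hzxy (Or.inr h), F, hF⟩

variable [Finite V] (k : Type v) [Field k]

/-- A branch with a single vertex `s` is the closed vertex `{s}`, joined to `w` by `E`. Let `J` be
generated by the `m_v` with `v ≠ s, w`. Setting `x_E = 0` leaves `J`, and the colon ideal by `x_E`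
is generated by the variable of the face `{s}`, by `m_w / x_E` and by `J`. So its projective
dimension exceeds that of `J`, because `w` has a face other than `E` with a neighbor. -/
lemma IsBranch.pd_eq_cancel (hsep : Separated H) (hdim : OneDimensional H) (hw : IsJoint H w)
    (hS : IsBranch H w S) (E : H) (hwE : w ∈ E.1) {s : V} (hSs : S = {s}) (hsE : s ∈ E.1) :
    pd k H = pd k (cancel k H E) := by
  have hsS : s ∈ S := by rw [hSs]; rfl
  have hsw : s ≠ w := fun h => hS.notMem (h ▸ hsS)
  have hE : E.1 = {w, s} := hdim.eq_pair E.2 hwE hsE hsw.symm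
  -- a face at `s` is `E` or the singleton
  have hface : ∀ F ∈ H, s ∈ F → w ∉ F → F = {s} := by
    intro F hF hsF hwF
    refine Set.Subset.antisymm (fun t ht => ?_) (Set.singleton_subset_iff.2 hsF)
    rw [← hSs]
    exact hS.mem_of_face hsS (fun h => hwF (h ▸ ht)) hF hsF ht
  obtain ⟨P, hP⟩ : ∃ P : H, P.1 = {s} := by
    obtain ⟨F, hF, _, _, ⟨hsF, _⟩, _, hwF⟩ := hsep s w hsw
    exact ⟨⟨F, hF⟩, hface F hF hsF hwF⟩
  have hPE : P ≠ E := fun h => by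
    have : w ∈ P.1 := h ▸ hwE
    rw [hP] at this
    exact hsw this.symm
  have hstar : star H s \ {E} = {P} := by
    ext F
    constructor
    · rintro ⟨hsF, hFE⟩
      refine Subtype.ext ((hface F.1 F.2 hsF fun hwF => hFE (Subtype.ext ?_)).trans hP.symm)
      rw [hE, hdim.eq_pair F.2 hwF hsF hsw.symm]
    · rintro rfl
      exact ⟨by rw [mem_star, hP]; rfl, hPE⟩
  have hPv : ∀ v, P ∈ star H v ↔ v = s := fun v => by rw [mem_star, hP]; rfl
  have hEv : ∀ v, E ∈ star H v ↔ v = w ∨ v = s := fun v => by rw [mem_star, hE]; rfl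
  rw [pd_cancel, pd_eq_famPd]
  · refine le_antisymm ?_ (famPd_erase_le _ _)
    refine (famPd_le_max_erase_avoid _ E).trans (max_le le_rfl ?_)
    set J := avoid (Set.range (star H)) {E}
    have hJv : ∀ t ∈ J, ∃ v, v ≠ w ∧ v ≠ s ∧ t = star H v := by
      rintro _ ⟨⟨v, rfl⟩, hv⟩
      rw [Set.disjoint_singleton_right, hEv] at hv
      push Not at hv
      exact ⟨v, hv.1, hv.2, rfl⟩
    obtain ⟨z, hzw, hzs, -, F, hF, hwF, hzF⟩ := hw.exists_face s s
    have hFwz := hdim.eq_pair hF hwF hzF hzw.symm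
    have hFE : (⟨F, hF⟩ : H) ≠ E := fun h => by
      have : z ∈ E.1 := h ▸ hzF
      rw [hE] at this
      exact this.elim hzw hzs
    have h1 : famPd k J ≤ famPd k (insert (star H w \ {E}) J) := by
      refine famPd_le_insert J _ (i := ⟨F, hF⟩) ⟨hwF, hFE⟩ ?_
      intro t ht t' ht' hFt hFt'
      obtain ⟨v, hvw, -, rfl⟩ := hJv t ht
      obtain ⟨v', hvw', -, rfl⟩ := hJv t' ht'
      have hz : ∀ u, u ≠ w → (⟨F, hF⟩ : H) ∈ star H u → u = z := fun u huw hu =>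
        (hFwz.le hu).resolve_left huw
      rw [hz v hvw hFt, hz v' hvw' hFt']
    have h2 : famPd k (insert (star H w \ {E}) J) + 1 ≤
        famPd k (insert {P} (insert (star H w \ {E}) J)) := by
      refine famPd_add_one_le _ _ ?_
      rintro _ (rfl | ht)
      · exact fun h => hsw ((hPv w).1 h.1).symm
      · obtain ⟨v, -, hvs, rfl⟩ := hJv _ ht
        exact fun h => hvs ((hPv v).1 h)
    have h3 : insert {P} (insert (star H w \ {E}) J) = erase (Set.range (star H)) {E} := by
      ext t
      constructor
      · rintro (rfl | rfl | ⟨⟨v, rfl⟩, hv⟩)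
        · exact ⟨_, ⟨s, rfl⟩, hstar⟩
        · exact ⟨_, ⟨w, rfl⟩, rfl⟩
        · exact ⟨_, ⟨v, rfl⟩, hv.sdiff_eq_left⟩
      · rintro ⟨_, ⟨v, rfl⟩, rfl⟩
        by_cases hvs : v = s
        · exact Or.inl (hvs ▸ hstar)
        by_cases hvw : v = w
        · exact Or.inr (Or.inl (by rw [hvw]))
        have hd : Disjoint (star H v) {E} := by
          rw [Set.disjoint_singleton_right, hEv]
          exact fun h => h.elim hvw hvs
        refine Or.inr (Or.inr ?_)
        change star H v \ {E} ∈ J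
        rw [hd.sdiff_eq_left]
        exact ⟨⟨v, rfl⟩, hd⟩
    calc famPd k J + 1 ≤ famPd k (insert (star H w \ {E}) J) + 1 := by gcongr
      _ ≤ _ := h2
      _ = _ := by rw [h3]
  · intro a b hab
    by_contra hne
    by_cases has : a = s
    · have : P ∈ star H b := hab ⟨(hPv a).2 has, hPE⟩
      exact hne (has.trans ((hPv b).1 this).symm)
    by_cases haw : a = w
    · subst haw
      obtain ⟨z, hza, hzs, hzb, F, hF, haF, hzF⟩ := hw.exists_face s b
      have hFE : (⟨F, hF⟩ : H) ≠ E := fun h => by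
        have : z ∈ E.1 := h ▸ hzF
        rw [hE] at this
        exact this.elim hza hzs
      have hb : b ∈ F := hab (show (⟨F, hF⟩ : H) ∈ star H a \ {E} from ⟨haF, hFE⟩)
      rw [hdim.eq_pair hF haF hzF hza.symm] at hb
      exact hb.elim (fun h => hne h.symm) (fun h => hzb h.symm)
    · obtain ⟨F, hF, _, _, ⟨haF, _⟩, _, hbF⟩ := hsep a b hne
      refine hbF (hab (show (⟨F, hF⟩ : H) ∈ star H a \ {E} from ⟨haF, fun h => ?_⟩))
      have : a ∈ E.1 := h ▸ haF
      rw [hE] at this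
      exact this.elim haw has

/-- With `J` generated by the `m_v` with `v ≠ c, d, w`, both sides are `pd J + 2`. For the lower
bound, keep one variable of `m_c` and one of `m_d` and set their other variables to `1`. For the
upper bound, split along the edge `e` from the open vertex `c` to `w`: over `e = 1` the generator
`m_c` becomes the variable of the edge `{c, d}`, which divides `m_d`, and over `e = 0` only `m_d`
is left besides `J`. -/
lemma IsBranch.pd_eq_remove (hsep : Separated H) (hdim : OneDimensional H)
    (hS : IsBranch H w S) {c d : V} (hcd : c ≠ d) (hScd : S = {c, d})
    (hc : ¬ IsClosedVertex H c) (hcw : {c, w} ∈ H) :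
    pd k H = pd k (remove H w) := by
  have hcS : c ∈ S := by rw [hScd]; exact Or.inl rfl
  have hdS : d ∈ S := by rw [hScd]; exact Or.inr rfl
  have hcw' : c ≠ w := fun h => hS.notMem (h ▸ hcS)
  have hdw' : d ≠ w := fun h => hS.notMem (h ▸ hdS)
  obtain ⟨e, he⟩ : ∃ e : H, e.1 = {c, w} := ⟨⟨_, hcw⟩, rfl⟩
  obtain ⟨f, hf⟩ : ∃ f : H, f.1 = {c, d} := by
    obtain ⟨x, hx, hxc, F, hF, hcF, hxF⟩ := hS.exists_face hcS hdS hcd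
    rw [hScd] at hx
    obtain rfl : x = d := hx.resolve_left hxc
    exact ⟨⟨F, hF⟩, hdim.eq_pair hF hcF hxF hcd⟩
  obtain ⟨h, hdh, hch⟩ : ∃ h : H, h ∈ star H d ∧ h ∉ star H c := by
    obtain ⟨F, hF, _, _, ⟨hdF, _⟩, _, hcF⟩ := hsep d c hcd.symm
    exact ⟨⟨F, hF⟩, hdF, hcF⟩
  have hev : ∀ v, e ∈ star H v ↔ v = c ∨ v = w := fun v => by rw [mem_star, he]; rfl
  have hfv : ∀ v, f ∈ star H v ↔ v = c ∨ v = d := fun v => by rw [mem_star, hf]; rfl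
  have hfe : f ≠ e := fun hfe => by
    have := (hfv d).2 (Or.inr rfl)
    rw [hfe, hev] at this
    exact this.elim hcd.symm hdw'
  -- a face meeting the branch contains no vertex outside of `c`, `d`, `w`
  have hout : ∀ v, v ≠ c → v ≠ d → v ≠ w → ∀ F ∈ star H v, F ∉ star H c ∪ star H d := by
    intro v hvc hvd hvw F hvF hF
    have : v ∈ S := by
      rcases hF with hF | hF
      · exact hS.mem_of_face hcS hvw F.2 hF hvF
      · exact hS.mem_of_face hdS hvw F.2 hF hvF
    rw [hScd] at this
    exact this.elim hvc hvd
  -- the open vertex `c` lies in `e` and `f` only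
  have hstarc : star H c ⊆ {e, f} := by
    intro F hcF
    by_cases hwF : w ∈ F.1
    · exact Or.inl (Subtype.ext (by rw [he, hdim.eq_pair F.2 hcF hwF hcw']))
    by_cases hdF : d ∈ F.1
    · exact Or.inr (Subtype.ext (by rw [hf, hdim.eq_pair F.2 hcF hdF hcd]))
    refine absurd ?_ hc
    have : F.1 = {c} := by
      refine Set.Subset.antisymm (fun t ht => ?_) (Set.singleton_subset_iff.2 hcF)
      have := hS.mem_of_face hcS (fun h => hwF (h ▸ ht)) F.2 hcF ht
      rw [hScd] at this
      exact this.resolve_right fun h => hdF (h ▸ ht)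
    rw [IsClosedVertex, ← this]
    exact F.2
  set J := star H '' {v | v ≠ c ∧ v ≠ d ∧ v ≠ w} with hJ
  have hlower : ∀ A : Set V, c ∈ A → d ∈ A → {v | v ≠ c ∧ v ≠ d ∧ v ≠ w} ⊆ A →
      famPd k J + 1 + 1 ≤ famPd k (star H '' A) := by
    intro A hcA hdA hA
    have h1 : famPd k J + 1 ≤ famPd k (insert {h} J) := by
      refine famPd_add_one_le J h ?_
      rintro _ ⟨v, ⟨hvc, hvd, hvw⟩, rfl⟩ hv
      exact hout v hvc hvd hvw h hv (Or.inr hdh)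
    have h2 : famPd k (insert {h} J) + 1 ≤ famPd k (insert {e} (insert {h} J)) := by
      refine famPd_add_one_le _ e ?_
      rintro _ (rfl | ⟨v, ⟨hvc, hvd, hvw⟩, rfl⟩) hv
      · rw [Set.mem_singleton_iff] at hv
        exact hch (hv ▸ (hev c).2 (Or.inl rfl))
      · exact ((hev v).1 hv).elim hvc hvw
    set T := (star H c ∪ star H d) \ {e, h}
    have hJT : ∀ v, v ≠ c → v ≠ d → v ≠ w → star H v \ T = star H v := by
      intro v hvc hvd hvw
      refine Disjoint.sdiff_eq_left (Set.disjoint_left.2 fun F hF hFT => ?_)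
      exact hout v hvc hvd hvw F hF hFT.1
    have h3 : famPd k (insert {e} (insert {h} J)) = famPd k (erase (star H '' A) T) := by
      refine famPd_congr ?_ ?_
      · rintro _ (rfl | rfl | ⟨v, ⟨hvc, hvd, hvw⟩, rfl⟩)
        · refine ⟨_, ⟨_, ⟨c, hcA, rfl⟩, rfl⟩, ?_⟩
          rintro F ⟨hF, hFT⟩
          have : F ∈ ({e, h} : Set H) := by
            by_contra hn
            exact hFT ⟨Or.inl hF, hn⟩
          exact this.resolve_right fun h => hch (h ▸ hF)
        · refine ⟨_, ⟨_, ⟨d, hdA, rfl⟩, rfl⟩, ?_⟩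
          rintro F ⟨hF, hFT⟩
          have : F ∈ ({e, h} : Set H) := by
            by_contra hn
            exact hFT ⟨Or.inr hF, hn⟩
          refine this.resolve_left fun h => ?_
          rw [h, hev] at hF
          exact hF.elim hcd.symm hdw'
        · exact ⟨_, ⟨_, ⟨v, hA ⟨hvc, hvd, hvw⟩, rfl⟩, rfl⟩, Set.sdiff_subset⟩
      · rintro _ ⟨_, ⟨v, hv, rfl⟩, rfl⟩
        have heT : e ∉ T := fun h => h.2 (Or.inl rfl)
        have hhT : h ∉ T := fun h => h.2 (Or.inr rfl)
        by_cases hvc : v = c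
        · exact ⟨{e}, Or.inl rfl, Set.singleton_subset_iff.2 ⟨(hev v).2 (Or.inl hvc), heT⟩⟩
        by_cases hvw : v = w
        · exact ⟨{e}, Or.inl rfl, Set.singleton_subset_iff.2 ⟨(hev v).2 (Or.inr hvw), heT⟩⟩
        by_cases hvd : v = d
        · exact ⟨{h}, Or.inr (Or.inl rfl), Set.singleton_subset_iff.2 ⟨hvd ▸ hdh, hhT⟩⟩
        · exact ⟨star H v, Or.inr (Or.inr ⟨v, ⟨hvc, hvd, hvw⟩, rfl⟩), (hJT v hvc hvd hvw).ge⟩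
    calc famPd k J + 1 + 1 ≤ famPd k (insert {h} J) + 1 := by gcongr
      _ ≤ _ := h2
      _ = _ := h3
      _ ≤ _ := famPd_erase_le _ _
  have htwo : ∀ s t, famPd k (insert s (insert t J)) ≤ famPd k J + 1 + 1 := fun s t =>
    (famPd_insert_le _ s).trans (by gcongr; exact famPd_insert_le J t)
  have hremove : famPd k (star H '' {w}ᶜ) = famPd k J + 1 + 1 := by
    refine le_antisymm (le_trans (le_of_eq ?_) (htwo (star H c) (star H d)))
      (hlower _ hcw' hdw' fun v hv => hv.2.2)
    congr 1
    rw [hJ, ← Set.image_insert_eq, ← Set.image_insert_eq]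
    congr 1
    ext v
    constructor
    · intro hv
      by_cases hvc : v = c
      · exact Or.inl hvc
      by_cases hvd : v = d
      · exact Or.inr (Or.inl hvd)
      · exact Or.inr (Or.inr ⟨hvc, hvd, hv⟩)
    · rintro (rfl | rfl | hv)
      · exact hcw'
      · exact hdw'
      · exact hv.2.2
  rw [pd_remove k hdim, hremove, pd_eq_famPd]
  refine le_antisymm ?_ ?_
  · refine (famPd_le_max_erase_avoid _ e).trans (max_le ?_ ?_)
    · refine le_trans (le_of_eq ?_) (htwo {f} (star H w \ {e}))
      refine famPd_congr ?_ ?_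
      · rintro _ ⟨_, ⟨v, rfl⟩, rfl⟩
        by_cases hvcd : v = c ∨ v = d
        · exact ⟨{f}, Or.inl rfl, Set.singleton_subset_iff.2 ⟨(hfv v).2 hvcd, hfe⟩⟩
        push Not at hvcd
        by_cases hvw : v = w
        · exact ⟨_, Or.inr (Or.inl rfl), by rw [hvw]⟩
        · refine ⟨star H v, Or.inr (Or.inr ⟨v, ⟨hvcd.1, hvcd.2, hvw⟩, rfl⟩), fun F hF => ⟨hF, ?_⟩⟩
          rintro rfl
          exact ((hev v).1 hF).elim hvcd.1 hvw
      · rintro _ (rfl | rfl | ⟨v, -, rfl⟩)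
        · refine ⟨_, ⟨_, ⟨c, rfl⟩, rfl⟩, ?_⟩
          rintro F ⟨hF, hFe⟩
          exact (hstarc hF).resolve_left hFe
        · exact ⟨_, ⟨_, ⟨w, rfl⟩, rfl⟩, subset_rfl⟩
        · exact ⟨_, ⟨_, ⟨v, rfl⟩, rfl⟩, Set.sdiff_subset⟩
    · gcongr
      refine le_trans (le_of_eq ?_) (famPd_insert_le J (star H d))
      congr 1
      ext t
      constructor
      · rintro ⟨⟨v, rfl⟩, hv⟩
        rw [Set.disjoint_singleton_right, hev] at hv
        push Not at hv
        by_cases hvd : v = d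
        · exact Or.inl (by rw [hvd])
        · exact Or.inr ⟨v, ⟨hv.1, hvd, hv.2⟩, rfl⟩
      · have : ∀ v, v ≠ c → v ≠ w → star H v ∈ avoid (Set.range (star H)) {e} := by
          intro v hvc hvw
          refine ⟨⟨v, rfl⟩, Set.disjoint_singleton_right.2 fun h => ?_⟩
          exact ((hev v).1 h).elim hvc hvw
        rintro (rfl | ⟨v, hv, rfl⟩)
        · exact this d hcd.symm hdw'
        · exact this v hv.1 hv.2.2
  · rw [← Set.image_univ]
    exact hlower _ trivial trivial (Set.subset_univ _)

end Branch

end DualHypergraph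

theorem proposition4p6 (k : Type v) [Field k] {V : Type u} [Finite V] (H : Set (Set V))
    (hcov : DualHypergraph.Covers H) (hsep : DualHypergraph.Separated H)
    (hdim : DualHypergraph.OneDimensional H)
    (w : V) (hw : DualHypergraph.IsJoint H w)
    (S : Set V) (hS : DualHypergraph.IsBranch H w S)
    (hclosed : ∀ a ∈ S, ∀ b ∈ S, (DualHypergraph.neighborGraph H).Adj a b →
      ¬ (DualHypergraph.IsClosedVertex H a ∧ DualHypergraph.IsClosedVertex H b))
    (E : H) (hwE : w ∈ E.1) (hES : (E.1 ∩ S).Nonempty) :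
    (S.encard = 1 →
      DualHypergraph.pd k H = DualHypergraph.pd k (DualHypergraph.cancel k H E)) ∧
    (S.encard = 2 →
      DualHypergraph.pd k H = DualHypergraph.pd k (DualHypergraph.remove H w)) := by
  open DualHypergraph in
  obtain ⟨a, haE, haS⟩ := hES
  refine ⟨fun h1 => ?_, fun h2 => ?_⟩
  · obtain ⟨s, hs⟩ := Set.encard_eq_one.1 h1
    have has : a = s := by rw [hs] at haS; exact haS
    exact hS.pd_eq_cancel k hsep hdim hw E hwE hs (has ▸ haE)
  · have haw : a ≠ w := fun h => hS.notMem (h ▸ haS)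
    have hEaw : {a, w} ∈ H := by
      rw [← hdim.eq_pair E.2 haE hwE haw]
      exact E.2
    obtain ⟨b, hab, hSab⟩ : ∃ b, a ≠ b ∧ S = {a, b} := by
      obtain ⟨x, y, hxy, hSxy⟩ := Set.encard_eq_two.1 h2
      rw [hSxy] at haS
      rcases haS with rfl | rfl
      · exact ⟨y, hxy, hSxy⟩
      · exact ⟨x, hxy.symm, hSxy.trans (Set.pair_comm _ _)⟩
    have hbS : b ∈ S := by rw [hSab]; exact Or.inr rfl
    have hbw : b ≠ w := fun h => hS.notMem (h ▸ hbS)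
    by_cases hac : IsClosedVertex H a
    · -- then `b` is open, and a face that separates it from `a` joins it to `w`
      have hbc : ¬ IsClosedVertex H b := by
        obtain ⟨c, hcS, hca, F, hF, haF, hcF⟩ := hS.exists_face haS hbS hab
        rw [hSab] at hcS
        obtain rfl : c = b := hcS.resolve_left hca
        exact fun hbc => hclosed a haS c hbS ⟨hab, F, hF, haF, hcF⟩ ⟨hac, hbc⟩
      have hEbw : {b, w} ∈ H := by
        obtain ⟨F, hF, _, _, ⟨hbF, _⟩, _, haF⟩ := hsep b a hab.symm
        by_cases hwF : w ∈ F
        · rwa [← hdim.eq_pair hF hbF hwF hbw]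
        · refine absurd ?_ hbc
          have : F = {b} := by
            refine Set.Subset.antisymm (fun t ht => ?_) (Set.singleton_subset_iff.2 hbF)
            have := hS.mem_of_face hbS (fun h => hwF (h ▸ ht)) hF hbF ht
            rw [hSab] at this
            exact this.resolve_left fun h => haF (h ▸ ht)
          rwa [this] at hF
      exact hS.pd_eq_remove k hsep hdim hab.symm (hSab.trans (Set.pair_comm _ _)) hbc hEbw
    · exact hS.pd_eq_remove k hsep hdim hab hSab hac hEaw
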